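/- Let $k$ be a field, $V$ a finite-dimensional $k$-vector space, and write $V^{(n)}=V^{\otimes n}$, $V^{(0)}=k$. Let $2\le a<b$ be integers, $R_a\subseteq V^{(a)}$ and $R_b\subseteq V^{(b)}$ subspaces, $R=R_a\oplus R_b$, and let $A=T(V)/\langle R\rangle$ with $V$ in degree $1$ (an $\{a,b\}$-multi-homogeneous algebra). Assume the minimality condition $$R_b\cap\sum_{j=0}^{b-a}V^{(j)}\otimes R_a\otimes V^{(b-a-j)}=0 ,$$ and assume that $R$ has a basis of monomials, i.e. that for some basis $x_1,\dots,x_m$ of $V$ the space $R$ has a basis consisting of monomials $x_{i_1}\cdots x_{i_n}$. Notation. For $s\in\{a,b\}$ put $n_s(2l)=sl$, $n_s(2l+1)=sl+1$, and for $n\ge s$ $$\bar J^s_n=\bigcap_{j=0}^{n-s}V^{(j)}\otimes R_s\otimes V^{(n-s-j)} .$$ Let $I_n=\sum_{s\in\{a,b\}}\sum_{j=0}^{n-s}V^{(j)}\otimes R_s\otimes V^{(n-s-j)}$ be the degree $n$ component of the ideal $\langle R\rangle$. Put $J_0=k$, $J_1=V$ and $J_i=\bar J^a_{n_a(i)}\oplus\bar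 J^b_{n_b(i)}$ for $i\ge 2$. The left multi-Koszul complex of $A$ is $K(A)_i=A\otimes J_i$, where for $i\ge 1$ the differential $\delta_i:A\otimes J_i\to A\otimes J_{i-1}$ is the restriction of $\alpha\otimes v_1\cdots v_n\mapsto\alpha v_1\otimes v_2\cdots v_n$ if $i$ is odd, and, on the summand of $J_i$ of degree $n=n_s(i)$, of $\alpha\otimes v_1\cdots v_n\mapsto\alpha v_1\cdots v_{s-1}\otimes v_s\cdots v_n$ if $i$ is even. The algebra $A$ is called multi-Koszul if this complex, together with the augmentation $K(A)_0=A\to k$, is a projective resolution of the trivial left $A$-module $k$. Then $A$ is multi-Koszul if and only if all of the following hold: (1) (extra conditions) for $s=a$ and for $s=b$, $$(V^{(s-1)}\otimes R_s)\cap\Big(\sum_{j=0}^{s-2}V^{(j)}\otimes R_s\otimes V^{(s-1-j)}\Big)=V^{(s-2)}\otimes\bar J^s_{s+1};$$ (2) for every integer $m$ with $b-a+1\le m\le b-1$, $$(V^{(m)}\otimes R_a)\cap\Big(\sum_{j=0}^{m+a-b-1}V^{(j)}\otimes R_b\otimes V^{(m+a-b-j)}\Big)\subseteq V^{(m-1)}\otimes\bar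 J^a_{a+1}+I_m\otimes R_a;$$ (3) for every integer $m$ with $1\le m\le a-1$, $$(V^{(m)}\otimes R_b)\cap\Big(\sum_{j=0}^{m+b-a-1}V^{(j)}\otimes R_a\otimes V^{(m+b-a-j)}\Big)\subseteq V^{(m-1)}\otimes\bar J^b_{b+1}.$$ -/

import Mathlib

open scoped TensorProduct

namespace MultiKoszul

universe u v

section TensorPowers

variable (k : Type u) (V : Type v) [Field k] [AddCommGroup V] [Module k V]

/-- `V^{(n)} = V^{⊗ n}`, as the degree `n` component of the tensor algebra `T(V)`.  For subspaces
`W ⊆ V^{(m)}` and `W' ⊆ V^{(n)}`, the subspace `W ⊗ W'` of `V^{(m+n)}` is the product `W * W'` of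
submodules of the algebra `T(V)`. -/
abbrev tpow (n : ℕ) : Submodule k (TensorAlgebra k V) :=
  (LinearMap.range (TensorAlgebra.ι k : V →ₗ[k] TensorAlgebra k V)) ^ n

/-- Auxiliary algebra map for `cut`: a vector `v` acts on `T(V) × (V ⊗ T(V))` by
`(x, y) ↦ (v x, v ⊗ x)`. -/
noncomputable def cutAux :
    TensorAlgebra k V →ₐ[k]
      Module.End k (TensorAlgebra k V × (V ⊗[k] TensorAlgebra k V)) :=
  TensorAlgebra.lift k
    { toFun := fun v =>
        LinearMap.prod
          (LinearMap.mulLeft k (TensorAlgebra.ι k v) ∘ₗ LinearMap.fst k _ _)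
          (TensorProduct.mk k V (TensorAlgebra k V) v ∘ₗ LinearMap.fst k _ _)
      map_add' := fun v w => by
        ext x <;> simp [add_mul]
      map_smul' := fun c v => by
        ext x <;> simp [TensorProduct.smul_tmul'] }

/-- The linear map `T(V) → V ⊗ T(V)` detaching the first letter:
`v_1 v_2 ⋯ v_n ↦ v_1 ⊗ v_2 ⋯ v_n` for `n ≥ 1`, and `1 ↦ 0`. -/
noncomputable def cut : TensorAlgebra k V →ₗ[k] V ⊗[k] TensorAlgebra k V :=
  LinearMap.snd k _ _ ∘ₗ LinearMap.applyₗ (1, 0) ∘ₗ (cutAux k V).toLinearMap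

variable {k V}

theorem cutAux_ι (v : V) (p : TensorAlgebra k V × (V ⊗[k] TensorAlgebra k V)) :
    cutAux k V (TensorAlgebra.ι k v) p = (TensorAlgebra.ι k v * p.1, v ⊗ₜ[k] p.1) := by
  simp [cutAux]

theorem cutAux_fst (t : TensorAlgebra k V)
    (p : TensorAlgebra k V × (V ⊗[k] TensorAlgebra k V)) :
    (cutAux k V t p).1 = t * p.1 := by
  induction t using TensorAlgebra.induction generalizing p with
  | algebraMap r => simp [Module.algebraMap_end_apply, Algebra.smul_def]
  | ι x => simp [cutAux_ι]
  | mul a b ha hb => simp [ha, hb, mul_assoc]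
  | add a b ha hb => simp [ha, hb, add_mul]

theorem cut_one : cut k V 1 = 0 := by
  simp [cut]

theorem cut_ι_mul (v : V) (t : TensorAlgebra k V) :
    cut k V (TensorAlgebra.ι k v * t) = v ⊗ₜ[k] t := by
  simp [cut, cutAux_ι, cutAux_fst]

/-- The multiplication map `V ⊗ T(V) → T(V)`. -/
noncomputable def glue : V ⊗[k] TensorAlgebra k V →ₗ[k] TensorAlgebra k V :=
  LinearMap.mul' k (TensorAlgebra k V) ∘ₗ (TensorAlgebra.ι k).rTensor (TensorAlgebra k V)

theorem glue_tmul (v : V) (t : TensorAlgebra k V) :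
    glue (v ⊗ₜ[k] t) = TensorAlgebra.ι k v * t := by
  simp [glue]

theorem cut_glue (z : V ⊗[k] TensorAlgebra k V) : cut k V (glue z) = z := by
  induction z with
  | zero => simp
  | tmul v t => rw [glue_tmul, cut_ι_mul]
  | add x y hx hy => simp [hx, hy]

theorem glue_mem (W : Submodule k (TensorAlgebra k V))
    (z : V ⊗[k] TensorAlgebra k V) (hz : z ∈ LinearMap.range (W.subtype.lTensor V)) :
    glue z ∈ tpow k V 1 * W := by
  obtain ⟨y, rfl⟩ := hz
  induction y with
  | zero => simp
  | tmul v t =>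
    rw [LinearMap.lTensor_tmul, glue_tmul, tpow, pow_one]
    exact Submodule.mul_mem_mul ⟨v, rfl⟩ t.2
  | add x y hx hy => rw [map_add, map_add]; exact add_mem hx hy

theorem cut_mem (W : Submodule k (TensorAlgebra k V)) (x : TensorAlgebra k V)
    (hx : x ∈ tpow k V 1 * W) :
    cut k V x ∈ LinearMap.range (W.subtype.lTensor V) ∧ glue (cut k V x) = x := by
  rw [tpow, pow_one] at hx
  induction hx using Submodule.mul_induction_on' with
  | mem_mul_mem m hm n hn =>
    obtain ⟨v, rfl⟩ := hm
    rw [cut_ι_mul, glue_tmul]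
    exact ⟨⟨v ⊗ₜ ⟨n, hn⟩, by simp⟩, rfl⟩
  | add x _ y _ hx hy =>
    rw [map_add, map_add, hx.2, hy.2]
    exact ⟨add_mem hx.1 hy.1, rfl⟩

theorem mem_range_lTensor_iff {ι : Type*} [DecidableEq ι] (b : Module.Basis ι k V)
    (W : Submodule k (TensorAlgebra k V)) (z : V ⊗[k] TensorAlgebra k V) :
    z ∈ LinearMap.range (W.subtype.lTensor V) ↔
      ∀ i, TensorProduct.equivFinsuppOfBasisLeft b z i ∈ W := by
  constructor
  · rintro ⟨y, rfl⟩ i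
    induction y with
    | zero => simp
    | tmul v t =>
      simpa using W.smul_mem _ t.2
    | add x y hx hy => rw [map_add, map_add, Finsupp.add_apply]; exact add_mem hx hy
  · intro h
    rw [← (TensorProduct.equivFinsuppOfBasisLeft b).symm_apply_apply z,
      TensorProduct.equivFinsuppOfBasisLeft_symm_apply]
    exact Submodule.sum_mem _ fun i _ => ⟨b i ⊗ₜ ⟨_, h i⟩, by simp⟩

/-- `V ⊗ -` commutes with (nonempty) intersections of subspaces. -/
theorem tpow_one_mul_iInf {ι : Type*} [Nonempty ι]
    (W : ι → Submodule k (TensorAlgebra k V)) :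
    (⨅ i, tpow k V 1 * W i) ≤ tpow k V 1 * ⨅ i, W i := by
  classical
  intro x hx
  rw [Submodule.mem_iInf] at hx
  obtain ⟨i₀⟩ := ‹Nonempty ι›
  rw [← (cut_mem (W i₀) x (hx i₀)).2]
  apply glue_mem
  rw [mem_range_lTensor_iff (Module.Basis.ofVectorSpace k V)]
  intro i
  rw [Submodule.mem_iInf]
  intro j
  exact (mem_range_lTensor_iff (Module.Basis.ofVectorSpace k V) (W j) _).1 (cut_mem (W j) x (hx j)).1 i

theorem tpow_mul_iInf {ι : Type*} [Nonempty ι] (c : ℕ)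
    (W : ι → Submodule k (TensorAlgebra k V)) :
    (⨅ i, tpow k V c * W i) ≤ tpow k V c * ⨅ i, W i := by
  induction c generalizing W with
  | zero => simp [tpow]
  | succ c ih =>
    have h : ∀ U : Submodule k (TensorAlgebra k V),
        tpow k V (c + 1) * U = tpow k V c * (tpow k V 1 * U) := fun U => by
      rw [← mul_assoc, tpow, pow_succ, tpow, tpow, pow_one]
    simp only [h]
    exact (ih fun i => tpow k V 1 * W i).trans (mul_le_mul' le_rfl (tpow_one_mul_iInf W))

end TensorPowers

/-- The data presenting an `S`-multi-homogeneous algebra `T(V)/⟨R⟩`: a finite set `S` of integers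
`≥ 2` and subspaces `R_s ⊆ V^{(s)}`, `s ∈ S`, such that `R = ⨁_{s ∈ S} R_s` satisfies the
minimality condition: `R_s` meets trivially the degree `s` part of the ideal generated by the
other `R_t`.  (The values of `rel` outside `S` are irrelevant.) -/
structure RelationSpace (k : Type u) (V : Type v) [Field k] [AddCommGroup V] [Module k V]
    (S : Finset ℕ) where
  two_le : ∀ s ∈ S, 2 ≤ s
  rel : ℕ → Submodule k (TensorAlgebra k V)
  rel_le : ∀ s ∈ S, rel s ≤ tpow k V s
  minimality : ∀ s ∈ S,
    rel s ⊓ (⨆ t ∈ S.erase s, ⨆ j ∈ Finset.range (s + 1 - t),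
      tpow k V j * rel t * tpow k V (s - t - j)) = ⊥

/-- `n_s(2l) = s l` and `n_s(2l+1) = s l + 1`. -/
def nDeg (s i : ℕ) : ℕ := s * (i / 2) + i % 2

theorem nDeg_ge {s i : ℕ} (hi : 2 ≤ i) : s ≤ nDeg s i :=
  le_trans (Nat.le_mul_of_pos_right s (by omega)) (Nat.le_add_right _ _)

theorem nDeg_even_succ {s i : ℕ} (hs : 2 ≤ s) (hi : i % 2 = 1) :
    nDeg s (i + 1) = (s - 1) + nDeg s i := by
  have h1 : (i + 1) / 2 = i / 2 + 1 := by omega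
  have h2 : (i + 1) % 2 = 0 := by omega
  rw [nDeg, nDeg, h1, h2, hi, Nat.mul_add]
  omega

theorem nDeg_odd_succ {s i : ℕ} (hi : i % 2 = 0) : nDeg s (i + 1) = 1 + nDeg s i := by
  have h1 : (i + 1) / 2 = i / 2 := by omega
  have h2 : (i + 1) % 2 = 1 := by omega
  rw [nDeg, nDeg, h1, h2, hi]
  omega

theorem nDeg_inj {s t i : ℕ} (hi : 2 ≤ i) (h : nDeg s i = nDeg t i) : s = t :=
  Nat.eq_of_mul_eq_mul_right (by omega : 0 < i / 2) (Nat.add_right_cancel h)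

namespace RelationSpace

variable {k : Type u} {V : Type v} [Field k] [AddCommGroup V] [Module k V] {S : Finset ℕ}
  (R : RelationSpace k V S)

/-- The two-sided ideal `⟨R⟩` of `T(V)` generated by `R = ⨁_{s ∈ S} R_s`. -/
def ideal : TwoSidedIdeal (TensorAlgebra k V) :=
  TwoSidedIdeal.span (⋃ s ∈ S, (R.rel s : Set (TensorAlgebra k V)))

/-- The algebra `A = T(V)/⟨R⟩`. -/
abbrev Alg : Type (max u v) := R.ideal.ringCon.Quotient

/-- The canonical projection `T(V) → A`. -/
def proj : TensorAlgebra k V →ₐ[k] R.Alg := R.ideal.ringCon.mkₐ k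

/-- The homogeneous component
`I_n = ∑_{s ∈ S} ∑_{j=0}^{n-s} V^{(j)} ⊗ R_s ⊗ V^{(n-s-j)}` of the ideal `⟨R⟩`. -/
def idealDeg (n : ℕ) : Submodule k (TensorAlgebra k V) :=
  ⨆ s ∈ S, ⨆ j ∈ Finset.range (n + 1 - s), tpow k V j * R.rel s * tpow k V (n - s - j)

/-- For `n ≥ s`, the subspace `J̄_n^s = ⋂_{j=0}^{n-s} V^{(j)} ⊗ R_s ⊗ V^{(n-s-j)}`. -/
def Jbar (s n : ℕ) : Submodule k (TensorAlgebra k V) :=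
  ⨅ j : Fin (n - s + 1), tpow k V j * R.rel s * tpow k V (n - s - j)

/-- `J_i = V^{(i)}` for `i = 0, 1`, and `J_i = ⨁_{s ∈ S} J_i^s` with `J_i^s = J̄^s_{n_s(i)}` for
`i ≥ 2`.  (For fixed `i ≥ 2` the integers `n_s(i)` are distinct, so that the sum is direct.) -/
def J (i : ℕ) : Submodule k (TensorAlgebra k V) :=
  if i < 2 then tpow k V i else ⨆ s ∈ S, R.Jbar s (nDeg s i)

/-- The `A`-linear endomorphism `α ⊗ v_1 v_2 ⋯ v_n ↦ α v_1 ⊗ v_2 ⋯ v_n` (`n ≥ 1`),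
`α ⊗ 1 ↦ 0` of `A ⊗ T(V)`. -/
noncomputable def step : R.Alg ⊗[k] TensorAlgebra k V →ₗ[R.Alg] R.Alg ⊗[k] TensorAlgebra k V :=
  TensorProduct.AlgebraTensorModule.lift
    (LinearMap.toSpanSingleton R.Alg
      (TensorAlgebra k V →ₗ[k] R.Alg ⊗[k] TensorAlgebra k V)
      ((R.proj.toLinearMap ∘ₗ TensorAlgebra.ι k).rTensor (TensorAlgebra k V) ∘ₗ cut k V))

theorem step_tmul_ι_mul (α : R.Alg) (v : V) (t : TensorAlgebra k V) :
    R.step (α ⊗ₜ[k] (TensorAlgebra.ι k v * t)) =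
      (α * R.proj (TensorAlgebra.ι k v)) ⊗ₜ[k] t := by
  simp [step, cut_ι_mul, TensorProduct.smul_tmul']

theorem step_tmul_one (α : R.Alg) : R.step (α ⊗ₜ[k] (1 : TensorAlgebra k V)) = 0 := by
  simp [step, cut_one]

/-- The map `δ̂_i` on `A ⊗ T(V)`.  For odd `i` it sends `α ⊗ v_1 ⋯ v_n` to `α v_1 ⊗ v_2 ⋯ v_n`; for
even `i` it sends `α ⊗ v_1 ⋯ v_n` with `n = n_s(i)`, `s ∈ S`, to
`α v_1 ⋯ v_{s-1} ⊗ v_s ⋯ v_n`. -/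
noncomputable def deltaHat (i : ℕ) :
    R.Alg ⊗[k] TensorAlgebra k V →ₗ[R.Alg] R.Alg ⊗[k] TensorAlgebra k V :=
  if i % 2 = 1 then R.step
  else ∑ s ∈ S, (R.step ^ (s - 1)) ∘ₗ
    (GradedAlgebra.proj (fun n => tpow k V n) (nDeg s i)).baseChange R.Alg

/-- The `i`-th module `K(A)_i = A ⊗ J_i` of the left multi-Koszul complex
(where `A ⊗ J_0 = A ⊗ k = A`). -/
abbrev K (i : ℕ) : Type (max u v) := R.Alg ⊗[k] R.J i

/-- The inclusion `A ⊗ J_i ⊆ A ⊗ T(V)`. -/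
noncomputable def incl (i : ℕ) : R.K i →ₗ[R.Alg] R.Alg ⊗[k] TensorAlgebra k V :=
  (R.J i).subtype.baseChange R.Alg

theorem incl_injective (i : ℕ) : Function.Injective (R.incl i) :=
  Module.Flat.lTensor_preserves_injective_linearMap (M := R.Alg) (R.J i).subtype
    (R.J i).injective_subtype

theorem step_pow_mem (c : ℕ) (W : Submodule k (TensorAlgebra k V)) (α : R.Alg)
    (w : TensorAlgebra k V) (hw : w ∈ tpow k V c * W) :
    (R.step ^ c) (α ⊗ₜ[k] w) ∈ W.baseChange R.Alg := by
  induction c generalizing α w with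
  | zero =>
    have hw' : w ∈ W := by simpa [tpow] using hw
    simpa using Submodule.tmul_mem_baseChange_of_mem α hw'
  | succ c ih =>
    have h : tpow k V (c + 1) * W
        = LinearMap.range (TensorAlgebra.ι k : V →ₗ[k] TensorAlgebra k V) *
          (tpow k V c * W) := by
      rw [← mul_assoc, tpow, pow_succ']
    rw [h] at hw
    induction hw using Submodule.mul_induction_on' with
    | mem_mul_mem m hm n hn =>
      obtain ⟨v, rfl⟩ := hm
      rw [pow_succ, Module.End.mul_apply, step_tmul_ι_mul]
      exact ih _ _ hn
    | add x _ y _ hx hy =>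
      rw [TensorProduct.tmul_add, map_add]
      exact add_mem hx hy

theorem Jbar_le_tpow {s n : ℕ} (hs : s ∈ S) (hn : s ≤ n) : R.Jbar s n ≤ tpow k V n := by
  refine (iInf_le _ (0 : Fin (n - s + 1))).trans ?_
  refine (mul_le_mul' (mul_le_mul' le_rfl (R.rel_le s hs)) le_rfl).trans ?_
  rw [tpow, tpow, tpow, tpow, ← pow_add, ← pow_add]
  simp [hn]

theorem Jbar_add_le {s c n : ℕ} (hn : s ≤ n) :
    R.Jbar s (c + n) ≤ tpow k V c * R.Jbar s n := by
  refine le_trans ?_ (tpow_mul_iInf c _)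
  refine le_iInf fun j => ?_
  refine (iInf_le _ (⟨c + j, by omega⟩ : Fin (c + n - s + 1))).trans ?_
  have h : c + n - s - (c + j) = n - s - j := by omega
  simp only [h]
  rw [← mul_assoc, ← mul_assoc, tpow, tpow, tpow, tpow, pow_add]

theorem Jbar_nDeg_le {s c i : ℕ} (hs : s ∈ S) (hc : nDeg s (i + 2) = c + nDeg s (i + 1)) :
    R.Jbar s (nDeg s (i + 2)) ≤ tpow k V c * R.J (i + 1) := by
  rcases i with _ | i
  · have h1 : nDeg s (0 + 1) = 1 := by simp [nDeg]
    have hJ : R.J (0 + 1) = tpow k V 1 := by simp [J]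
    refine (R.Jbar_le_tpow hs (nDeg_ge (by omega))).trans (le_of_eq ?_)
    rw [hc, h1, hJ, tpow, tpow, tpow, pow_add]
  · rw [hc]
    refine (R.Jbar_add_le (nDeg_ge (by omega))).trans (mul_le_mul' le_rfl ?_)
    have hJ : R.J (i + 1 + 1) = ⨆ s ∈ S, R.Jbar s (nDeg s (i + 1 + 1)) := by
      simp [J]
    rw [hJ]
    exact le_iSup₂_of_le s hs le_rfl

theorem proj_baseChange {n m : ℕ} (α : R.Alg) {w : TensorAlgebra k V} (hw : w ∈ tpow k V n) :
    (GradedAlgebra.proj (fun n => tpow k V n) m).baseChange R.Alg (α ⊗ₜ[k] w) =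
      if m = n then α ⊗ₜ[k] w else 0 := by
  rw [LinearMap.baseChange_tmul, GradedAlgebra.proj_apply]
  split_ifs with h
  · subst h
    rw [DirectSum.decompose_of_mem_same _ hw]
  · rw [DirectSum.decompose_of_mem_ne (fun n => tpow k V n) hw (Ne.symm h), TensorProduct.tmul_zero]

theorem deltaHat_of_odd {i : ℕ} (hi : i % 2 = 1) : R.deltaHat i = R.step := by
  simp [deltaHat, hi]

/-- The description of `δ̂_i` on the component of degree `n_s(i)`, for even `i ≥ 2`. -/
theorem deltaHat_of_even {i s : ℕ} (hi : i % 2 = 0) (h2 : 2 ≤ i) (hs : s ∈ S) (α : R.Alg)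
    {w : TensorAlgebra k V} (hw : w ∈ tpow k V (nDeg s i)) :
    R.deltaHat i (α ⊗ₜ[k] w) = (R.step ^ (s - 1)) (α ⊗ₜ[k] w) := by
  have hi' : ¬ i % 2 = 1 := by omega
  rw [deltaHat, if_neg hi', LinearMap.sum_apply, Finset.sum_eq_single s]
  · rw [LinearMap.comp_apply, R.proj_baseChange α hw, if_pos rfl]
  · intro t _ hts
    rw [LinearMap.comp_apply, R.proj_baseChange α hw, if_neg fun h => hts (nDeg_inj h2 h), map_zero]
  · exact fun h => absurd hs h

theorem deltaHat_mem (i : ℕ) (α : R.Alg) (w : TensorAlgebra k V) (hw : w ∈ R.J (i + 1)) :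
    R.deltaHat (i + 1) (α ⊗ₜ[k] w) ∈ (R.J i).baseChange R.Alg := by
  rcases i with _ | i
  · have h0 : R.J 0 = tpow k V 0 := by simp [J]
    have h1 : R.J (0 + 1) = tpow k V 1 := by simp [J]
    rw [h1] at hw
    rw [R.deltaHat_of_odd (by omega), h0]
    simpa using R.step_pow_mem 1 (tpow k V 0) α w (by simpa [tpow] using hw)
  · have hJ : R.J (i + 1 + 1) = ⨆ s : S, R.Jbar s (nDeg s (i + 2)) := by
      rw [J, if_neg (by omega), iSup_subtype]
    rw [hJ] at hw
    induction hw using Submodule.iSup_induction' with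
    | mem s x hx =>
      rcases Nat.mod_two_eq_zero_or_one (i + 1) with h | h
      · rw [R.deltaHat_of_odd (by omega)]
        simpa using R.step_pow_mem 1 _ α x (R.Jbar_nDeg_le s.2 (nDeg_odd_succ h) hx)
      · rw [R.deltaHat_of_even (by omega) (by omega) s.2 α
          (R.Jbar_le_tpow s.2 (nDeg_ge (by omega)) hx)]
        exact R.step_pow_mem _ _ α x
          (R.Jbar_nDeg_le s.2 (nDeg_even_succ (R.two_le s s.2) h) hx)
    | zero => simp
    | add x y _ _ hx hy =>
      rw [TensorProduct.tmul_add, map_add]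
      exact add_mem hx hy

theorem deltaHat_incl_mem (i : ℕ) (x : R.K (i + 1)) :
    R.deltaHat (i + 1) (R.incl (i + 1) x) ∈ LinearMap.range (R.incl i) := by
  induction x using TensorProduct.induction_on with
  | zero => simp
  | tmul α w => exact R.deltaHat_mem i α w w.2
  | add x y hx hy => rw [map_add, map_add]; exact add_mem hx hy

/-- The differential `δ_{i+1} : A ⊗ J_{i+1} → A ⊗ J_i` of the left multi-Koszul complex, the
restriction of `δ̂_{i+1}`. -/
noncomputable def delta (i : ℕ) : R.K (i + 1) →ₗ[R.Alg] R.K i :=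
  (LinearEquiv.ofInjective (R.incl i) (R.incl_injective i)).symm.toLinearMap ∘ₗ
    (R.deltaHat (i + 1) ∘ₗ R.incl (i + 1)).codRestrict (LinearMap.range (R.incl i))
      (R.deltaHat_incl_mem i)

theorem incl_delta (i : ℕ) (x : R.K (i + 1)) :
    R.incl i (R.delta i x) = R.deltaHat (i + 1) (R.incl (i + 1) x) := by
  have h := LinearEquiv.apply_symm_apply
    (LinearEquiv.ofInjective (R.incl i) (R.incl_injective i))
    ((R.deltaHat (i + 1) ∘ₗ R.incl (i + 1)).codRestrict (LinearMap.range (R.incl i))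
      (R.deltaHat_incl_mem i) x)
  exact congrArg Subtype.val h

theorem ideal_le_ker :
    R.ideal.ringCon ≤
      RingCon.ker (TensorAlgebra.algebraMapInv : TensorAlgebra k V →ₐ[k] k).toRingHom := by
  have h : R.ideal ≤ TwoSidedIdeal.ker
      (TensorAlgebra.algebraMapInv : TensorAlgebra k V →ₐ[k] k).toRingHom := by
    refine TwoSidedIdeal.span_le.2 ?_
    intro x hx
    simp only [Set.mem_iUnion] at hx
    obtain ⟨s, hs, hx⟩ := hx
    refine (TwoSidedIdeal.mem_ker _).2 ?_
    have hx' := R.rel_le s hs hx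
    clear hx
    obtain ⟨m, rfl⟩ : ∃ m, s = m + 1 := ⟨s - 1, by have := R.two_le s hs; omega⟩
    rw [tpow, pow_succ'] at hx'
    induction hx' using Submodule.mul_induction_on' with
    | mem_mul_mem m hm n hn =>
      obtain ⟨v, rfl⟩ := hm
      simp [TensorAlgebra.algebraMapInv]
    | add x _ y _ hx hy => rw [map_add, hx, hy, add_zero]
  exact TwoSidedIdeal.ringCon_le_iff.1 h

/-- The augmentation `A → k` of the connected graded algebra `A`, killing `V`. -/
noncomputable def augmentation : R.Alg →ₐ[k] k :=
  R.ideal.ringCon.liftₐ TensorAlgebra.algebraMapInv R.ideal_le_ker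

/-- The augmentation `δ_0 : K(A)_0 = A ⊗ k → k` of the complex, induced by that of `A`. -/
noncomputable def delta0 : R.K 0 →ₗ[k] k :=
  LinearMap.mul' k k ∘ₗ
    TensorProduct.map R.augmentation.toLinearMap
      ((TensorAlgebra.algebraMapInv : TensorAlgebra k V →ₐ[k] k).toLinearMap ∘ₗ (R.J 0).subtype)

/-- `A` is (left) multi-Koszul: the augmented left multi-Koszul complex
`⋯ → A ⊗ J_2 → A ⊗ J_1 → A ⊗ J_0 → k → 0` is a projective resolution of the trivial module `k`. -/
def IsMultiKoszul : Prop :=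
  (∀ i, Module.Projective R.Alg (R.K i)) ∧
  Function.Surjective R.delta0 ∧
  Function.Exact (R.delta 0) R.delta0 ∧
  ∀ i, Function.Exact (R.delta (i + 1)) (R.delta i)

/-- `R = ⨁_{s ∈ S} R_s` has a basis of monomials: for some basis `x_1, …, x_m` of `V`, it has a
basis consisting of monomials `x_{i_1} ⋯ x_{i_n}`. -/
def HasMonomialBasis : Prop :=
  ∃ (m : ℕ) (x : Module.Basis (Fin m) k V) (B : Set (TensorAlgebra k V)),
    (∀ w ∈ B, ∃ l : List (Fin m), w = (l.map fun i => TensorAlgebra.ι k (x i)).prod) ∧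
    LinearIndependent k (fun w : B => (w : TensorAlgebra k V)) ∧
    Submodule.span k B = ⨆ s ∈ S, R.rel s

/-- The extra condition in degree `s`:
`(V^{(s-1)} ⊗ R_s) ∩ ∑_{j=0}^{s-2} V^{(j)} ⊗ R_s ⊗ V^{(s-1-j)} = V^{(s-2)} ⊗ J̄_{s+1}^s`. -/
def ExtraCondition (s : ℕ) : Prop :=
  (tpow k V (s - 1) * R.rel s) ⊓
      (⨆ j ∈ Finset.range (s - 1), tpow k V j * R.rel s * tpow k V (s - 1 - j)) =
    tpow k V (s - 2) * R.Jbar s (s + 1)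

end RelationSpace

end MultiKoszul

/-! For monomial relations everything is combinatorics of words. The words form a basis of `T(V)`,
and the subspaces that occur are spans of sets of words, so intersections, sums and products become
operations on sets (`wordSpan`). The irreducible words give a basis of `A`, and the pairs `(α, w)`,
with `α` irreducible and `w` a word of `J_i`, give a basis of `A ⊗ J_i`.

The differential moves a prefix of `w` to `α` and gives zero exactly when the new left word is
reducible (`deltaHat_pairWord`, `pairWord_eq_zero`). Since `shift` is injective on these pairs
(`shift_inj`), the kernel is spanned by the pairs that are killed (`mem_span_of_map_eq_zero`).
Exactness therefore says that each killed pair is the shift of a pair one degree higher.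

At `K(A)_2` this is `OverlapCondition`: a relation straddling `α` and a proper prefix of `w` forces
`w` to extend one letter to the left inside `α w`. Applied to the first `s` letters of longer
chains, and iterated, it yields exactness in all higher degrees (`exists_shift_eq`); exactness at
`K(A)_1` and `K(A)_0` is automatic.

Cutting `α` where the overlapping relation begins bounds its length. Sorting the overlaps by the
degrees of the two relations gives (1), (2) and (3) (`overlapCondition_pair_iff`,
`inf_le_iff_overlapAt`). -/

namespace MultiKoszul

/-! ### Subspaces of the tensor algebra spanned by monomials -/

section WordSpan

variable {k V ι : Type*} [Field k] [AddCommGroup V] [Module k V] (x : Module.Basis ι k V)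

/-- The monomial `x_{i_1} ⋯ x_{i_n}` of `T(V)` attached to the word `i_1, …, i_n`. -/
noncomputable def word (l : List ι) : TensorAlgebra k V :=
  (l.map fun i => TensorAlgebra.ι k (x i)).prod

theorem word_nil : word x [] = 1 := rfl

theorem word_cons (i : ι) (l : List ι) :
    word x (i :: l) = TensorAlgebra.ι k (x i) * word x l := by
  simp [word]

theorem word_append (l l' : List ι) : word x (l ++ l') = word x l * word x l' := by
  simp [word]

/-- The basis of `T(V)` consisting of the monomials. -/
noncomputable def wordBasis : Module.Basis (List ι) k (TensorAlgebra k V) :=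
  x.tensorAlgebra.reindex FreeMonoid.toList

theorem wordBasis_apply (l : List ι) : wordBasis x l = word x l := by
  have h : wordBasis x l = (TensorAlgebra.equivFreeAlgebra x).symm
      (FreeAlgebra.equivMonoidAlgebraFreeMonoid.symm (MonoidAlgebra.of k _ (FreeMonoid.ofList l))) := by
    simp only [wordBasis, Module.Basis.tensorAlgebra, FreeAlgebra.basisFreeMonoid,
      Module.Basis.reindex_apply, Module.Basis.map_apply, Finsupp.coe_basisSingleOne]
    rfl
  rw [h]
  clear h
  induction l with
  | nil => simp [word_nil, ← MonoidAlgebra.one_def]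
  | cons i l ih =>
    rw [FreeMonoid.ofList_cons, map_mul, map_mul, map_mul, ih, word_cons]
    simp [FreeAlgebra.equivMonoidAlgebraFreeMonoid]

theorem coe_wordBasis : ⇑(wordBasis x) = word x := funext (wordBasis_apply x)

theorem linearIndependent_word : LinearIndependent k (word x) :=
  coe_wordBasis x ▸ (wordBasis x).linearIndependent

/-- The subspace of `T(V)` spanned by a set of monomials. -/
noncomputable def wordSpan (X : Set (List ι)) : Submodule k (TensorAlgebra k V) :=
  Submodule.span k (word x '' X)

theorem mem_wordSpan {X : Set (List ι)} {t : TensorAlgebra k V} :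
    t ∈ wordSpan x X ↔ ∀ l, (wordBasis x).repr t l ≠ 0 → l ∈ X := by
  rw [wordSpan, ← coe_wordBasis, Module.Basis.mem_span_image]
  simp [Set.subset_def]

theorem word_mem_wordSpan {X : Set (List ι)} {l : List ι} :
    word x l ∈ wordSpan x X ↔ l ∈ X := by
  rw [wordSpan, ← coe_wordBasis, Module.Basis.self_mem_span_image]

theorem wordSpan_le_iff {X Y : Set (List ι)} : wordSpan x X ≤ wordSpan x Y ↔ X ⊆ Y := by
  refine ⟨fun h l hl => ?_, fun h => Submodule.span_mono (Set.image_mono h)⟩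
  exact (word_mem_wordSpan x).1 (h ((word_mem_wordSpan x).2 hl))

/-- Membership is a condition on the support of the coordinates, because the words are a basis;
spans of arbitrary families would not commute with intersections. -/
theorem wordSpan_iInter {κ : Sort*} (X : κ → Set (List ι)) :
    wordSpan x (⋂ i, X i) = ⨅ i, wordSpan x (X i) := by
  ext t
  simp only [Submodule.mem_iInf, mem_wordSpan, Set.mem_iInter]
  exact ⟨fun h i l hl => h l hl i, fun h l hl i => h i l hl⟩

theorem wordSpan_inter (X Y : Set (List ι)) :
    wordSpan x (X ∩ Y) = wordSpan x X ⊓ wordSpan x Y := by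
  ext t
  simp only [Submodule.mem_inf, mem_wordSpan, Set.mem_inter_iff]
  exact ⟨fun h => ⟨fun l hl => (h l hl).1, fun l hl => (h l hl).2⟩,
    fun h l hl => ⟨h.1 l hl, h.2 l hl⟩⟩

theorem wordSpan_iUnion {κ : Sort*} (X : κ → Set (List ι)) :
    wordSpan x (⋃ i, X i) = ⨆ i, wordSpan x (X i) := by
  simp only [wordSpan, Set.image_iUnion, Submodule.span_iUnion]

theorem wordSpan_union (X Y : Set (List ι)) :
    wordSpan x (X ∪ Y) = wordSpan x X ⊔ wordSpan x Y := by
  rw [wordSpan, Set.image_union, Submodule.span_union]; rfl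

theorem wordSpan_empty : wordSpan x (∅ : Set (List ι)) = ⊥ := by
  simp [wordSpan]

theorem wordSpan_mul (X Y : Set (List ι)) :
    wordSpan x X * wordSpan x Y = wordSpan x (Set.image2 (· ++ ·) X Y) := by
  rw [wordSpan, wordSpan, Submodule.span_mul_span, wordSpan]
  congr 1
  ext t
  simp only [Set.mem_mul, Set.mem_image, Set.mem_image2]
  constructor
  · rintro ⟨_, ⟨l, hl, rfl⟩, _, ⟨l', hl', rfl⟩, rfl⟩
    exact ⟨_, ⟨l, hl, l', hl', rfl⟩, word_append x l l'⟩
  · rintro ⟨_, ⟨l, hl, l', hl', rfl⟩, rfl⟩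
    exact ⟨_, ⟨l, hl, rfl⟩, _, ⟨l', hl', rfl⟩, (word_append x l l').symm⟩

theorem tpow_eq_wordSpan (n : ℕ) : tpow k V n = wordSpan x {l | l.length = n} := by
  induction n with
  | zero =>
    have h : {l : List ι | l.length = 0} = {[]} := by ext; simp
    rw [tpow, pow_zero, h, wordSpan, Set.image_singleton, word_nil, Submodule.one_eq_span]
  | succ n ih =>
    have h : LinearMap.range (TensorAlgebra.ι k : V →ₗ[k] TensorAlgebra k V) =
        wordSpan x {l | l.length = 1} := by
      rw [LinearMap.range_eq_map, ← x.span_eq, Submodule.map_span, wordSpan]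
      congr 1
      ext t
      simp only [Set.mem_image, Set.mem_range, Set.mem_ofPred_eq, List.length_eq_one_iff]
      constructor
      · rintro ⟨_, ⟨i, rfl⟩, rfl⟩
        exact ⟨[i], ⟨i, rfl⟩, by simp [word]⟩
      · rintro ⟨_, ⟨i, rfl⟩, rfl⟩
        exact ⟨_, ⟨i, rfl⟩, by simp [word]⟩
    rw [tpow, pow_succ, ← tpow, ih, h, wordSpan_mul]
    congr 1
    ext l
    simp only [Set.mem_image2, Set.mem_ofPred_eq]
    constructor
    · rintro ⟨_, rfl, _, h', rfl⟩
      simp [h']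
    · intro hl
      exact ⟨l.take n, by simp [hl], l.drop n, by simp [hl], l.take_append_drop n⟩

theorem tpow_mul_wordSpan (j : ℕ) (P : Set (List ι)) :
    tpow k V j * wordSpan x P = wordSpan x {l | j ≤ l.length ∧ l.drop j ∈ P} := by
  rw [tpow_eq_wordSpan x, wordSpan_mul]
  congr 1
  ext l
  simp only [Set.mem_image2, Set.mem_ofPred_eq]
  constructor
  · rintro ⟨u, rfl, w, h, rfl⟩
    simp [h]
  · rintro ⟨h, h'⟩
    exact ⟨l.take j, by simp [h], l.drop j, h', l.take_append_drop j⟩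

/-- As all words of `P` have the same length, the middle factor is recovered by its position alone.
-/
theorem tpow_mul_wordSpan_mul_tpow {s : ℕ} (j c : ℕ) {P : Set (List ι)}
    (hP : ∀ w ∈ P, w.length = s) :
    tpow k V j * wordSpan x P * tpow k V c =
      wordSpan x {l | l.length = j + s + c ∧ (l.drop j).take s ∈ P} := by
  rw [tpow_mul_wordSpan, tpow_eq_wordSpan x, wordSpan_mul]
  congr 1
  ext l
  simp only [Set.mem_image2, Set.mem_ofPred_eq]
  constructor
  · rintro ⟨u, ⟨h1, h2⟩, w, h, rfl⟩
    have := hP _ h2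
    rw [List.length_drop] at this
    rw [List.drop_append_of_le_length h1, List.take_append_of_le_length (by simp; omega),
      List.take_of_length_le (by simp; omega)]
    exact ⟨by simp; omega, h2⟩
  · rintro ⟨h, h'⟩
    refine ⟨l.take (j + s), ⟨by simp; omega, ?_⟩, l.drop (j + s), by simp; omega,
      l.take_append_drop _⟩
    rw [List.drop_take]
    simpa using h'

end WordSpan

/-! ### Reducible words, chains and overlaps -/

section Words

variable {ι : Type*} (S : Finset ℕ) (P : ℕ → Set (List ι))

/-- Sets `P s` of words of length `s ≥ 2`, for `s ∈ S`, none of which contains another one. -/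
structure IsMinimalRelations : Prop where
  two_le : ∀ s ∈ S, 2 ≤ s
  length_eq : ∀ s ∈ S, ∀ w ∈ P s, w.length = s
  infix_eq : ∀ s ∈ S, ∀ t ∈ S, ∀ p ∈ P s, ∀ q ∈ P t, q <:+: p → q = p

/-- A word is reducible if it contains one of the relations. -/
def Reducible (w : List ι) : Prop := ∃ s ∈ S, ∃ p ∈ P s, p <:+: w

variable {S P}

theorem Reducible.mono {w w' : List ι} (h : Reducible S P w) (hw : w <:+: w') :
    Reducible S P w' := by
  obtain ⟨s, hs, p, hp, h⟩ := h
  exact ⟨s, hs, p, hp, h.trans hw⟩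

theorem take_drop_infix (w : List ι) (j s : ℕ) : (w.drop j).take s <:+: w :=
  (List.take_prefix _ _).isInfix.trans (List.drop_suffix _ _).isInfix

theorem IsMinimalRelations.not_reducible (hP : IsMinimalRelations S P) {s : ℕ} (hs : s ∈ S)
    {p w : List ι} (hp : p ∈ P s) (hw : w <:+: p) (hlt : w.length < s) : ¬ Reducible S P w := by
  rintro ⟨t, ht, q, hq, h⟩
  have := hP.infix_eq s hs t ht p hp q hq (h.trans hw)
  have h1 := h.length_le
  rw [this, hP.length_eq s hs p hp] at h1
  omega

variable (P) in
/-- The words of length `n` all of whose factors of length `s` lie in `P s`. -/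
def chain (s n : ℕ) : Set (List ι) :=
  {w | w.length = n ∧ ∀ j, j + s ≤ n → (w.drop j).take s ∈ P s}

theorem chain_self (hP : IsMinimalRelations S P) {s : ℕ} (hs : s ∈ S) : chain P s s = P s := by
  ext w
  constructor
  · rintro ⟨h, h'⟩
    simpa [List.take_of_length_le h.le] using h' 0 (by omega)
  · intro h
    have hl := hP.length_eq s hs w h
    refine ⟨hl, fun j hj => ?_⟩
    obtain rfl : j = 0 := by omega
    simpa [List.take_of_length_le hl.le] using h

theorem cons_mem_chain {s n : ℕ} {w : List ι} {y : ι} (hw : w ∈ chain P s n)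
    (hy : (y :: w).take s ∈ P s) : y :: w ∈ chain P s (n + 1) := by
  refine ⟨by simp [hw.1], fun j hj => ?_⟩
  rcases j with _ | j
  · exact hy
  · exact hw.2 j (by omega)

theorem take_mem_of_mem_chain {s n : ℕ} {w : List ι} (hw : w ∈ chain P s n) (hn : s ≤ n) :
    w.take s ∈ P s := by
  simpa using hw.2 0 (by omega)

/-- The relation `w ∈ P s` extends one letter to the left inside of `α w`. -/
def ExtendsLeft (P : ℕ → Set (List ι)) (s : ℕ) (α w : List ι) : Prop :=
  ∃ β y, α = β ++ [y] ∧ (y :: w).take s ∈ P s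

variable (S P) in
/-- If `α` is irreducible and a relation inside of `α w`, `w ∈ P s`, overlaps `w` without being a
suffix, then `w` extends one letter to the left inside of `α w`. -/
def OverlapCondition : Prop :=
  ∀ s ∈ S, ∀ α, ¬ Reducible S P α → ∀ w ∈ P s, Reducible S P (α ++ w.take (s - 1)) →
    ExtendsLeft P s α w

/-- Only the first relation of the chain matters: prepending a letter creates a single new window,
and that window sees only `w.take s`. -/
theorem OverlapCondition.chain (hO : OverlapCondition S P) {s n : ℕ} (hs : s ∈ S) (hn : s ≤ n)
    {α w : List ι} (hα : ¬ Reducible S P α) (hw : w ∈ chain P s n)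
    (hr : Reducible S P (α ++ w.take (s - 1))) :
    ∃ β y, α = β ++ [y] ∧ y :: w ∈ MultiKoszul.chain P s (n + 1) := by
  obtain ⟨β, y, rfl, hy⟩ := hO s hs α hα (w.take s) (take_mem_of_mem_chain hw hn) (by
    rwa [List.take_take, min_eq_left (by omega)])
  refine ⟨β, y, rfl, cons_mem_chain hw ?_⟩
  rcases s with _ | s
  · simpa using hy
  · rw [List.take_succ_cons, List.take_take, min_eq_left (by omega)] at hy
    rwa [List.take_succ_cons]

/-- Letters are transferred one at a time. While fewer than `s - 1` have been transferred, the
reducible word `α ++ w.take 1` is still a prefix of `β ++ (γ ++ w).take (s - 1)`, so the overlap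
condition applies again. -/
theorem OverlapCondition.chain_iterate (hO : OverlapCondition S P) {s n : ℕ} (hs : s ∈ S)
    (hn : s ≤ n) {α w : List ι} (hα : ¬ Reducible S P α) (hw : w ∈ MultiKoszul.chain P s n)
    (hr : Reducible S P (α ++ w.take 1)) (c : ℕ) (hc : c ≤ s - 1) :
    ∃ β γ, α = β ++ γ ∧ γ.length = c ∧ γ ++ w ∈ MultiKoszul.chain P s (n + c) := by
  induction c with
  | zero => exact ⟨α, [], by simp, rfl, hw⟩
  | succ c ih =>
    obtain ⟨β, γ, rfl, hγ, hγw⟩ := ih (by omega)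
    clear ih
    have h1 : 1 ≤ s - 1 - γ.length := hγ ▸ Nat.le_sub_of_add_le' hc
    have hp : β ++ γ ++ w.take 1 <+: β ++ (γ ++ w).take (s - 1) := by
      rw [List.append_assoc, List.prefix_append_right_inj, List.take_append,
        List.take_of_length_le (l := γ) (by omega), List.prefix_append_right_inj]
      exact List.take_prefix_take_left h1
    obtain ⟨β', y, rfl, hy⟩ := hO.chain (α := β) hs (by omega)
      (fun h => hα (h.mono (List.prefix_append _ _).isInfix)) hγw (hr.mono hp.isInfix)
    exact ⟨β', y :: γ, by simp, by simp [hγ], hy⟩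

/-! ### The combinatorial differential on pairs of words -/

variable (S P) in
/-- The words spanning `J_i`. -/
def chainWords (i : ℕ) : Set (List ι) :=
  if i < 2 then {w | w.length = i} else {w | ∃ s ∈ S, w ∈ chain P s (nDeg s i)}

/-- The number of letters removed by the `i`-th differential from a word of length `n`. -/
def cutLen (i n : ℕ) : ℕ := if i % 2 = 1 then 1 else n / (i / 2) - 1

theorem cutLen_odd {i n : ℕ} (hi : i % 2 = 1) : cutLen i n = 1 := if_pos hi

theorem cutLen_even {i s : ℕ} (hi : i % 2 = 0) (h : 2 ≤ i) : cutLen i (nDeg s i) = s - 1 := by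
  rw [cutLen, if_neg (by omega), nDeg, hi, add_zero, Nat.mul_div_cancel _ (by omega)]

theorem nDeg_succ {i s : ℕ} (hs : 2 ≤ s) (hi : 1 ≤ i) :
    nDeg s (i + 1) = cutLen (i + 1) (nDeg s (i + 1)) + nDeg s i := by
  rcases Nat.mod_two_eq_zero_or_one i with h | h
  · rw [cutLen_odd (by omega), nDeg_odd_succ h]
  · rw [cutLen_even (by omega) (by omega), nDeg_even_succ hs h]

/-- Consecutive differentials move `1` and `s - 1` letters in some order, together one whole
relation; this is why they compose to zero. -/
theorem cutLen_add_cutLen {i s : ℕ} (hs : 2 ≤ s) (hi : 1 ≤ i) :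
    cutLen (i + 1) (nDeg s (i + 1)) + cutLen i (nDeg s i) = s := by
  rcases Nat.mod_two_eq_zero_or_one i with h | h
  · rw [cutLen_odd (by omega), cutLen_even h (by omega)]
    omega
  · rw [cutLen_odd h, cutLen_even (by omega) (by omega)]
    omega

/-- The `i`-th differential `(α, w) ↦ (α w', w'')` on pairs of words, `w = w' w''`. -/
def shift (i : ℕ) (p : List ι × List ι) : List ι × List ι :=
  (p.1 ++ p.2.take (cutLen i p.2.length), p.2.drop (cutLen i p.2.length))

theorem shift_append (i : ℕ) (p : List ι × List ι) :
    (shift i p).1 ++ (shift i p).2 = p.1 ++ p.2 := by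
  simp [shift]

theorem shift_eq_iff {i : ℕ} {p q : List ι × List ι} :
    shift i p = q ↔ p.1 ++ p.2 = q.1 ++ q.2 ∧ (shift i p).2.length = q.2.length := by
  constructor
  · rintro rfl
    exact ⟨(shift_append i p).symm, rfl⟩
  · rintro ⟨h, hl⟩
    rw [← shift_append i p] at h
    exact Prod.ext_iff.2 (List.append_inj' h hl)

theorem length_shift_snd (hP : IsMinimalRelations S P) {i s : ℕ} (hi : 1 ≤ i) (hs : s ∈ S)
    {p : List ι × List ι} (hp : p.2 ∈ chain P s (nDeg s (i + 1))) :
    (shift (i + 1) p).2.length = nDeg s i := by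
  have := nDeg_succ (hP.two_le s hs) hi
  rw [shift, List.length_drop, hp.1]
  omega

theorem chainWords_of_two_le {i : ℕ} (hi : 2 ≤ i) :
    chainWords S P i = {w | ∃ s ∈ S, w ∈ chain P s (nDeg s i)} :=
  if_neg (by omega)

theorem shift_snd_mem_chainWords (hP : IsMinimalRelations S P) {i : ℕ} (hi : 1 ≤ i)
    {p : List ι × List ι} (hp : p.2 ∈ chainWords S P (i + 1)) :
    (shift (i + 1) p).2 ∈ chainWords S P i := by
  rw [chainWords_of_two_le (by omega)] at hp
  obtain ⟨s, hs, hp⟩ := hp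
  have hl := length_shift_snd hP hi hs hp
  rcases Nat.lt_or_ge i 2 with h2 | h2
  · obtain rfl : i = 1 := by omega
    rw [chainWords, if_pos h2]
    exact hl.trans (by simp [nDeg])
  · rw [chainWords_of_two_le h2]
    refine ⟨s, hs, hl, fun j hj => ?_⟩
    have := nDeg_succ (hP.two_le s hs) hi
    rw [shift, List.drop_drop, hp.1]
    exact hp.2 _ (by omega)

/-- Concatenation is preserved, so only the length of the right word has to be recovered. In degree
at least 3 the length after the shift determines `s`. In degree 2 that length is always 1, and
minimality is needed: two relations that are suffixes of one word coincide. -/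
theorem shift_inj (hP : IsMinimalRelations S P) {i : ℕ} (hi : 1 ≤ i) {p q : List ι × List ι}
    (hp : p.2 ∈ chainWords S P i) (hq : q.2 ∈ chainWords S P i) (h : shift i p = shift i q) :
    p = q := by
  have hpq : p.1 ++ p.2 = q.1 ++ q.2 := by rw [← shift_append i, h, shift_append]
  suffices hl : p.2.length = q.2.length from Prod.ext_iff.2 (List.append_inj' hpq hl)
  obtain ⟨i, rfl⟩ : ∃ j, i = j + 1 := ⟨i - 1, by omega⟩
  rcases Nat.eq_zero_or_pos i with rfl | hi
  · simp only [chainWords] at hp hq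
    exact hp.trans hq.symm
  · rw [chainWords_of_two_le (by omega)] at hp hq
    obtain ⟨s, hs, hp⟩ := hp
    obtain ⟨t, ht, hq⟩ := hq
    have h1 : nDeg s i = nDeg t i := by
      rw [← length_shift_snd hP hi hs hp, ← length_shift_snd hP hi ht hq, h]
    suffices s = t by rw [hp.1, hq.1, this]
    rcases Nat.lt_or_ge i 2 with h2 | h2
    · obtain rfl : i = 1 := by omega
      have hd : ∀ s, nDeg s (1 + 1) = s := fun s => by simp [nDeg]
      rw [hd, chain_self hP hs] at hp
      rw [hd, chain_self hP ht] at hq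
      have key : p.2 = q.2 := by
        rcases List.suffix_or_suffix_of_suffix (List.suffix_append p.1 p.2)
          (hpq ▸ List.suffix_append q.1 q.2) with h | h
        · exact hP.infix_eq t ht s hs _ hq _ hp h.isInfix
        · exact (hP.infix_eq s hs t ht _ hp _ hq h.isInfix).symm
      rw [← hP.length_eq s hs _ hp, ← hP.length_eq t ht _ hq, key]
    · exact nDeg_inj h2 h1

/-- The two shifts together move exactly the first `s` letters of the chain, which form a relation.
-/
theorem reducible_shift_shift (hP : IsMinimalRelations S P) {i : ℕ} {p : List ι × List ι}
    (hp : p.2 ∈ chainWords S P (i + 2)) :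
    Reducible S P (shift (i + 1) (shift (i + 2) p)).1 := by
  rw [chainWords_of_two_le (by omega)] at hp
  obtain ⟨s, hs, hp⟩ := hp
  have h2 := cutLen_add_cutLen (i := i + 1) (hP.two_le s hs) (by omega)
  have hl := length_shift_snd hP (by omega) hs hp
  refine ⟨s, hs, _, take_mem_of_mem_chain hp (nDeg_ge (by omega)), List.IsSuffix.isInfix ?_⟩
  rw [shift, hl]
  simp only [shift, hp.1]
  rw [List.append_assoc, ← List.take_add, h2]
  exact List.suffix_append _ _

/-- Combinatorial exactness at degree `i`. For `i = 1` the relation created by adding one letter to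
an irreducible word must be a suffix, so it is the required chain. For larger `i` the preimage takes
from `α` one letter if `i` is even and `s - 1` letters if `i` is odd. -/
theorem exists_shift_eq (hP : IsMinimalRelations S P) (hO : OverlapCondition S P) {i : ℕ}
    (hi : 1 ≤ i) {p : List ι × List ι} (hp : p.2 ∈ chainWords S P i)
    (hn : ¬ Reducible S P p.1) (hr : Reducible S P (shift i p).1) :
    ∃ q : List ι × List ι, q.2 ∈ chainWords S P (i + 1) ∧ ¬ Reducible S P q.1 ∧
      shift (i + 1) q = p := by
  obtain ⟨α, w⟩ := p
  rw [chainWords_of_two_le (by omega)]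
  rcases Nat.lt_or_ge i 2 with h2 | h2
  · obtain rfl : i = 1 := by omega
    obtain ⟨x, rfl⟩ : ∃ x, w = [x] := List.length_eq_one_iff.1 hp
    obtain ⟨s, hs, q, hq, hqi⟩ := hr
    have hl := hP.length_eq s hs q hq
    have hsuf : q <:+ α ++ [x] := by
      have h : (shift 1 (α, [x])).1 = α ++ [x] := by simp [shift, cutLen]
      rw [h, List.infix_concat_iff] at hqi
      exact hqi.resolve_right fun h => hn ⟨s, hs, q, hq, h⟩
    obtain ⟨β, hβ⟩ := hsuf
    have hqc : q ∈ chain P s (nDeg s 2) := by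
      have : nDeg s 2 = s := by simp [nDeg]
      rwa [this, chain_self hP hs]
    refine ⟨(β, q), ⟨s, hs, hqc⟩, fun h => hn (h.mono ?_), shift_eq_iff.2 ⟨hβ, ?_⟩⟩
    -- Since `q` has at least two letters, `β` is a prefix of `α`.
    · have h2 := hP.two_le s hs
      have h3 := congrArg List.length hβ
      rw [List.length_append, List.length_append, List.length_singleton] at h3
      exact (List.prefix_of_prefix_length_le (hβ ▸ List.prefix_append β q)
        (List.prefix_append α [x]) (show β.length ≤ α.length by omega)).isInfix
    · rw [length_shift_snd hP le_rfl hs hqc]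
      simp [nDeg]
  · rw [chainWords_of_two_le h2] at hp
    obtain ⟨s, hs, hw⟩ := hp
    have h2s := hP.two_le s hs
    have hsn : s ≤ nDeg s i := nDeg_ge h2
    rcases Nat.mod_two_eq_zero_or_one i with h | h
    · obtain ⟨β, y, rfl, hy⟩ := hO.chain hs hsn hn hw (by
        simpa only [shift, hw.1, cutLen_even h h2] using hr)
      rw [add_comm, ← nDeg_odd_succ h] at hy
      refine ⟨(β, y :: w), ⟨s, hs, hy⟩,
        fun h => hn (h.mono (List.prefix_append _ _).isInfix), shift_eq_iff.2 ⟨by simp, ?_⟩⟩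
      rw [length_shift_snd hP hi hs hy, hw.1]
    · obtain ⟨β, γ, rfl, hγ, hy⟩ := hO.chain_iterate hs hsn hn hw (by
        simpa only [shift, hw.1, cutLen_odd h] using hr) (s - 1) le_rfl
      rw [add_comm, ← nDeg_even_succ h2s h] at hy
      refine ⟨(β, γ ++ w), ⟨s, hs, hy⟩,
        fun h => hn (h.mono (List.prefix_append _ _).isInfix), shift_eq_iff.2 ⟨by simp, ?_⟩⟩
      rw [length_shift_snd hP hi hs hy, hw.1]

/-- A preimage of `(α, w)` is a chain of degree 3 whose tail is `w`; the length of `w` shows that it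
belongs to the same `s`, and its first letter is the extension sought. -/
theorem overlapCondition_of_exists_shift_eq (hP : IsMinimalRelations S P)
    (h : ∀ p : List ι × List ι, p.2 ∈ chainWords S P 2 → ¬ Reducible S P p.1 →
      Reducible S P (shift 2 p).1 → ∃ q, q.2 ∈ chainWords S P 3 ∧ shift 3 q = p) :
    OverlapCondition S P := by
  intro s hs α hα w hw hr
  have hl := hP.length_eq s hs w hw
  have hd : nDeg s 2 = s := by simp [nDeg]
  have hw2 : w ∈ chain P s (nDeg s 2) := by rwa [hd, chain_self hP hs]
  have hc : cutLen 2 s = s - 1 := by simp [cutLen]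
  obtain ⟨⟨β, z⟩, hz, hq⟩ := h (α, w)
    (by rw [chainWords_of_two_le le_rfl]; exact ⟨s, hs, hw2⟩) hα (by simpa [shift, hl, hc] using hr)
  rw [chainWords_of_two_le (by omega)] at hz
  obtain ⟨t, ht, hz⟩ := hz
  have hl' := length_shift_snd hP (by omega) ht hz
  rw [hq] at hl'
  obtain rfl : t = s := by
    rw [← hl, hl']
    simp [nDeg]
  rcases z with _ | ⟨y, z⟩
  · have := hz.1
    simp [nDeg] at this
  · simp only [shift, cutLen_odd (show 3 % 2 = 1 from rfl), Prod.mk.injEq, List.take_succ_cons,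
      List.take_zero, List.drop_succ_cons, List.drop_zero] at hq
    obtain ⟨rfl, rfl⟩ := hq
    exact ⟨β, y, rfl, take_mem_of_mem_chain hz (nDeg_ge (by omega))⟩

end Words

/-! ### Sorting the overlaps by degree -/

section TwoDegrees

variable {ι : Type*} {S : Finset ℕ} {P : ℕ → Set (List ι)}

theorem extendsLeft_append {s : ℕ} {α w : List ι} (hα : α ≠ []) (γ : List ι) :
    ExtendsLeft P s (γ ++ α) w ↔ ExtendsLeft P s α w := by
  constructor
  · rintro ⟨β, y, h, hy⟩
    obtain ⟨β', z, rfl⟩ := List.eq_nil_or_concat' α |>.resolve_left hα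
    rw [← List.append_assoc] at h
    obtain ⟨-, h⟩ := List.append_inj' h rfl
    exact ⟨β', y, by rw [h], hy⟩
  · rintro ⟨β, y, rfl, hy⟩
    exact ⟨γ ++ β, y, by simp, hy⟩

/-- What remains is the last letter of `α` followed by `w`: a word with two windows, the second
being `w` itself. -/
theorem drop_mem_chain_iff (hP : IsMinimalRelations S P) {s m : ℕ} (hs : s ∈ S) (hm : 1 ≤ m)
    {α w : List ι} (hα : α.length = m) (hw : w ∈ P s) :
    (α ++ w).drop (m - 1) ∈ chain P s (s + 1) ↔ ExtendsLeft P s α w := by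
  obtain ⟨β, y, rfl⟩ := List.eq_nil_or_concat' α |>.resolve_left (by rintro rfl; simp at hα; omega)
  have h : (β ++ [y] ++ w).drop (m - 1) = y :: w := by
    have : m - 1 = β.length := by simp at hα; omega
    rw [this]
    simp
  rw [h]
  constructor
  · intro h
    exact ⟨β, y, rfl, take_mem_of_mem_chain h (by omega)⟩
  · rintro ⟨β', y', h, hy⟩
    obtain ⟨-, h⟩ := List.append_inj' h rfl
    obtain rfl : y = y' := by simpa using h
    exact cons_mem_chain ((chain_self hP hs).symm ▸ hw) hy

variable (P) in
/-- If some factor `v_{j+1} ⋯ v_{j+t}`, `j < r`, of the word `α w` with `w ∈ P s` and `|α| = m`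
lies in `P t`, then `w` extends one letter to the left or `α` lies in `Z`. -/
def OverlapAt (s t m r : ℕ) (Z : Set (List ι)) : Prop :=
  ∀ α w : List ι, α.length = m → w ∈ P s → ∀ j < r, ((α ++ w).drop j).take t ∈ P t →
    ExtendsLeft P s α w ∨ α ∈ Z

/-- Here `α` may be reducible a priori. Discarding its first `j` letters leaves a nonempty proper
prefix of a relation, which is irreducible by minimality, and extension to the left depends only on
the last letter. -/
theorem OverlapCondition.overlapAt_of_prefix (hP : IsMinimalRelations S P)
    (hO : OverlapCondition S P) {s : ℕ} (hs : s ∈ S) : OverlapAt P s s (s - 1) (s - 1) ∅ := by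
  intro α w hα hw j hj h
  left
  have hl := hP.length_eq s hs w hw
  rw [List.drop_append_of_le_length (by omega)] at h
  have hne : α.drop j ≠ [] := fun h0 => by
    have := congrArg List.length h0
    simp at this
    omega
  rw [← List.take_append_drop j α, extendsLeft_append hne]
  have hlen : (α.drop j).length = s - 1 - j := by simp [hα]
  refine hO s hs _ (hP.not_reducible hs h ?_ (by omega)) w hw ⟨s, hs, _, h, ?_⟩
  · exact (List.prefix_take_iff.2 ⟨List.prefix_append _ _, by omega⟩).isInfix
  · refine List.IsPrefix.isInfix ?_
    have h1 : α.drop j ++ w.take (s - 1) = (α.drop j ++ w).take (s - 1 - j + (s - 1)) := by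
      rw [List.take_append, List.take_of_length_le (l := α.drop j) (by omega), hlen]
      congr 2
      omega
    rw [h1]
    exact List.take_prefix_take_left (by omega)

theorem OverlapCondition.overlapAt (hO : OverlapCondition S P)
    {s t : ℕ} (hs : s ∈ S) (ht : t ∈ S) (m : ℕ) :
    OverlapAt P s t m (m + s - t) {α | Reducible S P α} := by
  intro α w hα hw j hj h
  refine or_iff_not_imp_right.2 fun hn => hO s hs α hn w hw ⟨t, ht, _, h, ?_⟩
  have h1 : α ++ w.take (s - 1) = (α ++ w).take (m + (s - 1)) := by
    rw [List.take_append, List.take_of_length_le (l := α) (by omega), hα]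
    congr 2
    omega
  rw [h1]
  -- The bound `j < m + s - t` says that the factor stops before the last letter of `α w`.
  have h2 : t + j ≤ m + (s - 1) := by omega
  have h3 : ((α ++ w).drop j).take t = (((α ++ w).take (m + (s - 1))).drop j).take t := by
    rw [List.drop_take, List.take_take, min_eq_left (by omega)]
  rw [h3]
  exact take_drop_infix _ _ _

/-- A relation in `α ++ w.take (s - 1)` starts inside `α`, since otherwise it would lie properly
inside `w`. Let `c` be the part of `α` from that point on. It is shorter than the relation because
`α` is irreducible, and replacing `α` by `c` does not affect extension to the left. -/
theorem overlapCondition_of_overlapAt (hP : IsMinimalRelations S P)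
    (h1 : ∀ s ∈ S, OverlapAt P s s (s - 1) (s - 1) ∅)
    (h2 : ∀ s ∈ S, ∀ t ∈ S, s ≠ t → ∀ m, 1 ≤ m → t + 1 ≤ m + s → m ≤ t - 1 →
      OverlapAt P s t m (m + s - t) {α | Reducible S P α}) :
    OverlapCondition S P := by
  rintro s hs α hα w hw ⟨t, ht, p, hp, u, v, hpu⟩
  have hlw := hP.length_eq s hs w hw
  have hlp := hP.length_eq t ht p hp
  have h2s := hP.two_le s hs
  rw [List.append_assoc, List.append_eq_append_iff] at hpu
  rcases hpu with ⟨c, rfl, hc⟩ | ⟨c, rfl, hc⟩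
  swap
  · exfalso
    have hi : p <:+: w.take (s - 1) := ⟨c, v, by rw [hc]; simp⟩
    exact hP.not_reducible hs hw (List.take_prefix _ w).isInfix (by simp; omega)
      ⟨t, ht, p, hp, hi⟩
  have hcne : c ≠ [] := by
    rintro rfl
    have hi : p <:+: w.take (s - 1) := ⟨[], v, by simpa using hc⟩
    exact hP.not_reducible hs hw (List.take_prefix _ w).isInfix (by simp; omega)
      ⟨t, ht, p, hp, hi⟩
  have hc1 : 1 ≤ c.length := List.length_pos_iff.2 hcne
  have hcn : ¬ Reducible S P c := fun h => hα (h.mono (List.suffix_append u c).isInfix)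
  have hct : c.length < t := by
    by_contra hge
    have : p <+: c := List.prefix_of_prefix_length_le (List.prefix_append p v)
      (hc ▸ List.prefix_append c _) (by omega)
    exact hcn ⟨t, ht, p, hp, this.isInfix⟩
  have hcs : t ≤ c.length + (s - 1) := by
    have := congrArg List.length hc
    simp at this
    omega
  have hpt : (c ++ w).take t = p := by
    have h3 : p <+: c ++ w :=
      (hc ▸ List.prefix_append p v : p <+: c ++ w.take (s - 1)).trans
        ((List.prefix_append_right_inj c).2 (List.take_prefix _ _))
    rw [List.prefix_iff_eq_take.1 h3, hlp]
  rw [extendsLeft_append hcne]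
  by_cases hst : s = t
  · subst hst
    obtain ⟨y, w', rfl⟩ := List.exists_cons_of_length_pos (l := w) (by omega)
    -- The hypothesis for equal degrees concerns left words of length exactly `s - 1`; `c` is padded
    -- on the left with an arbitrary letter, here the first one of `w`.
    rw [← extendsLeft_append hcne (List.replicate (s - 1 - c.length) y)]
    refine (h1 s hs _ _ (by simp; omega) hw (s - 1 - c.length) (by omega) ?_).resolve_right id
    rw [List.append_assoc, List.drop_append_of_le_length (by simp)]
    simpa [hpt] using hp
  · exact (h2 s hs t ht hst c.length hc1 (by omega) (by omega) c w rfl hw 0 (by omega)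
      (by simpa [hpt] using hp)).resolve_right hcn

/-- An overlap of a relation of degree `t` with `w ∈ P s` needs `t + 1 ≤ m + s` and `m ≤ t - 1`. For
`s = a`, `t = b` this is the range in (2), where `α` may be reducible. For `s = b`, `t = a` the
first bound is automatic and `α` has fewer than `a` letters, too few to be reducible; hence no ideal
term in (3). -/
theorem overlapCondition_pair_iff {a b : ℕ} (hab : a < b) (hP : IsMinimalRelations {a, b} P) :
    OverlapCondition {a, b} P ↔
      (OverlapAt P a a (a - 1) (a - 1) ∅ ∧ OverlapAt P b b (b - 1) (b - 1) ∅) ∧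
      (∀ m, b - a + 1 ≤ m → m ≤ b - 1 →
        OverlapAt P a b m (m + a - b) {α | Reducible {a, b} P α}) ∧
      (∀ m, 1 ≤ m → m ≤ a - 1 → OverlapAt P b a m (m + b - a) ∅) := by
  have ha : a ∈ ({a, b} : Finset ℕ) := by simp
  have hb : b ∈ ({a, b} : Finset ℕ) := by simp
  constructor
  · intro hO
    refine ⟨⟨hO.overlapAt_of_prefix hP ha, hO.overlapAt_of_prefix hP hb⟩,
      fun m _ _ => hO.overlapAt ha hb m, fun m _ hm α w hα hw j hj h => ?_⟩
    refine (hO.overlapAt hb ha m α w hα hw j hj h).imp_right ?_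
    rintro ⟨s, hs, p, hp, hi⟩
    have h1 := hP.length_eq s hs p hp
    have h2 := hi.length_le
    have h3 := hP.two_le s hs
    rcases Finset.mem_insert.1 hs with rfl | hs
    · omega
    · rw [Finset.mem_singleton] at hs
      omega
  · rintro ⟨⟨h1, h2⟩, h3, h4⟩
    refine overlapCondition_of_overlapAt hP ?_ ?_
    · intro s hs
      rcases Finset.mem_insert.1 hs with rfl | hs
      · exact h1
      · rwa [Finset.mem_singleton.1 hs]
    · intro s hs t ht hst m hm1 hm2 hm3
      simp only [Finset.mem_insert, Finset.mem_singleton] at hs ht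
      rcases hs with rfl | rfl <;> rcases ht with rfl | rfl
      · exact absurd rfl hst
      · exact h3 m (by omega) hm3
      · exact fun α w hα hw j hj h => (h4 m hm1 hm3 α w hα hw j hj h).imp_right False.elim
      · exact absurd rfl hst

end TwoDegrees

/-! ### Linear maps sending basis vectors to basis vectors or zero -/

section PartialMaps

variable {k M M' X Y : Type*} [Field k] [AddCommGroup M] [Module k M] [AddCommGroup M']
  [Module k M'] {v : X → M} {v' : Y → M'} {φ : X → Y} {f : M →ₗ[k] M'} {T : Set X} {N : Set Y}

theorem span_image_le_of_eq_zero {N : Set X} (hv : ∀ x ∉ N, v x = 0) :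
    Submodule.span k (v '' T) ≤ Submodule.span k (v '' (T ∩ N)) := by
  rw [Submodule.span_le]
  rintro _ ⟨x, hx, rfl⟩
  by_cases h : x ∈ N
  · exact Submodule.subset_span ⟨x, ⟨hx, h⟩, rfl⟩
  · rw [SetLike.mem_coe, hv x h]
    exact zero_mem _

/-- The vanishing members of `T` contribute nothing to the span, so independence on `N` decides.
This turns membership in an image back into a statement about words. -/
theorem mem_of_mem_span_image {N : Set X} (hN : LinearIndepOn k v N) (hv : ∀ x ∉ N, v x = 0)
    {x : X} (hx : x ∈ N) (h : v x ∈ Submodule.span k (v '' T)) : x ∈ T := by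
  by_contra hxT
  have h' := span_image_le_of_eq_zero hv h
  have : (⟨x, hx⟩ : N) ∉ (Subtype.val ⁻¹' T : Set N) := hxT
  refine hN.linearIndependent.notMem_span_image this ?_
  have h2 : (fun y : N => v y) '' (Subtype.val ⁻¹' T) = v '' (T ∩ N) := by
    ext m
    constructor
    · rintro ⟨y, hy, rfl⟩
      exact ⟨y, ⟨hy, y.2⟩, rfl⟩
    · rintro ⟨y, hy, rfl⟩
      exact ⟨⟨y, hy.2⟩, hy.1, rfl⟩
  exact h2 ▸ h'

/-- A linear map which sends basis vectors to distinct basis vectors or to `0` has its kernel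
spanned by the basis vectors which it kills. -/
theorem mem_span_of_map_eq_zero (hf : ∀ x ∈ T, f (v x) = v' (φ x)) (hv : ∀ y ∉ N, v' y = 0)
    (hN : LinearIndepOn k v' N) (hφ : Set.InjOn φ (T ∩ φ ⁻¹' N)) {m : M}
    (hm : m ∈ Submodule.span k (v '' T)) (h0 : f m = 0) :
    m ∈ Submodule.span k (v '' (T \ φ ⁻¹' N)) := by
  rw [← Set.sdiff_union_inter T (φ ⁻¹' N), Set.image_union, Submodule.span_union,
    Submodule.mem_sup] at hm
  obtain ⟨m₁, h₁, m₂, h₂, rfl⟩ := hm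
  have h3 : f m₁ = 0 := by
    have : Submodule.span k (v '' (T \ φ ⁻¹' N)) ≤ LinearMap.ker f := by
      rw [Submodule.span_le]
      rintro _ ⟨x, ⟨hx, hx'⟩, rfl⟩
      rw [SetLike.mem_coe, LinearMap.mem_ker, hf x hx, hv _ hx']
    exact this h₁
  rw [map_add, h3, zero_add] at h0
  -- The surviving vectors have distinct, independent images, so `f` is injective on their span and
  -- the component `m₂` vanishes.
  have h4 : LinearIndependent k (f ∘ fun x : ↥(T ∩ φ ⁻¹' N) => v x) := by
    have : (f ∘ fun x : ↥(T ∩ φ ⁻¹' N) => v x) =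
        (fun y : N => v' y) ∘ fun x : ↥(T ∩ φ ⁻¹' N) => (⟨φ x, x.2.2⟩ : N) := by
      funext x
      exact hf x x.2.1
    rw [this]
    refine hN.linearIndependent.comp _ fun x y h => Subtype.ext (hφ x.2 y.2 ?_)
    exact congrArg Subtype.val h
  have h5 := Submodule.disjoint_def.1 (Submodule.range_ker_disjoint h4) m₂
    (by rwa [Set.image_eq_range] at h₂) h0
  rw [h5, add_zero]
  exact h₁

end PartialMaps

/-! ### Monomial bases of the algebra and of the complex -/

namespace RelationSpace

variable {k V ι : Type*} [Field k] [AddCommGroup V] [Module k V] {S : Finset ℕ}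
  {R : RelationSpace k V S} {x : Module.Basis ι k V} {P : ℕ → Set (List ι)}

theorem idealDeg_eq_wordSpan (hP : IsMinimalRelations S P)
    (hR : ∀ s ∈ S, R.rel s = wordSpan x (P s)) (n : ℕ) :
    R.idealDeg n = wordSpan x {l | l.length = n ∧ Reducible S P l} := by
  have h : {l : List ι | l.length = n ∧ Reducible S P l} =
      ⋃ s ∈ S, ⋃ j ∈ Finset.range (n + 1 - s),
        {l | l.length = j + s + (n - s - j) ∧ (l.drop j).take s ∈ P s} := by
    ext l
    simp only [Set.mem_ofPred_eq, Set.mem_iUnion, Finset.mem_range, exists_prop]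
    constructor
    · rintro ⟨rfl, s, hs, p, hp, u, v, rfl⟩
      have := hP.length_eq s hs p hp
      refine ⟨s, hs, u.length, by simp; omega, by simp; omega, ?_⟩
      rw [List.append_assoc, List.drop_left, ← this, List.take_left, this]
      exact hp
    · rintro ⟨s, hs, j, hj, hl, h⟩
      exact ⟨by omega, s, hs, _, h, take_drop_infix l j s⟩
  simp only [h, wordSpan_iUnion, idealDeg]
  refine iSup_congr fun s => iSup_congr fun hs => iSup_congr fun j => iSup_congr fun _ => ?_
  rw [hR s hs, tpow_mul_wordSpan_mul_tpow x _ _ (hP.length_eq s hs)]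

theorem Jbar_eq_wordSpan (hP : IsMinimalRelations S P)
    (hR : ∀ s ∈ S, R.rel s = wordSpan x (P s)) {s n : ℕ} (hs : s ∈ S) (hn : s ≤ n) :
    R.Jbar s n = wordSpan x (chain P s n) := by
  have h : chain P s n = ⋂ j : Fin (n - s + 1),
      {l : List ι | l.length = j + s + (n - s - j) ∧ (l.drop j).take s ∈ P s} := by
    ext l
    simp only [chain, Set.mem_ofPred_eq, Set.mem_iInter]
    constructor
    · rintro ⟨hl, h⟩ j
      exact ⟨by omega, h j (by omega)⟩
    · intro h
      refine ⟨by have := (h 0).1; simp at this; omega, fun j hj => (h ⟨j, by omega⟩).2⟩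
  rw [h, wordSpan_iInter, Jbar]
  refine iInf_congr fun j => ?_
  rw [hR s hs, tpow_mul_wordSpan_mul_tpow x _ _ (hP.length_eq s hs)]

theorem J_eq_wordSpan (hP : IsMinimalRelations S P)
    (hR : ∀ s ∈ S, R.rel s = wordSpan x (P s)) (i : ℕ) :
    R.J i = wordSpan x (chainWords S P i) := by
  rw [J, chainWords]
  split_ifs with hi
  · exact tpow_eq_wordSpan x i
  · have h : {w | ∃ s ∈ S, w ∈ chain P s (nDeg s i)} = ⋃ s ∈ S, chain P s (nDeg s i) := by
      ext; simp
    rw [h]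
    simp only [wordSpan_iUnion]
    exact iSup_congr fun s => iSup_congr fun hs => Jbar_eq_wordSpan hP hR hs (nDeg_ge (by omega))

/-- Reducibility survives adding letters on either side, so the reducible words span a two-sided
ideal, and each of them is a multiple of a relation. -/
theorem mem_ideal_iff (hR : ∀ s ∈ S, R.rel s = wordSpan x (P s)) (t : TensorAlgebra k V) :
    t ∈ R.ideal ↔ t ∈ wordSpan x {l | Reducible S P l} := by
  have htop : ∀ y, y ∈ wordSpan x (Set.univ : Set (List ι)) := fun y => by
    simp [mem_wordSpan]
  let I : TwoSidedIdeal (TensorAlgebra k V) := TwoSidedIdeal.mk'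
    (wordSpan x {l | Reducible S P l} : Set (TensorAlgebra k V)) (zero_mem _)
    (fun h h' => add_mem h h') (fun h => neg_mem h)
    (fun {y z} h => by
      refine (?_ : _ ≤ wordSpan x {l | Reducible S P l}) (Submodule.mul_mem_mul (htop y) h)
      rw [wordSpan_mul, wordSpan_le_iff]
      rintro _ ⟨u, -, w, hw, rfl⟩
      exact hw.mono (List.suffix_append _ _).isInfix)
    (fun {y z} h => by
      refine (?_ : _ ≤ wordSpan x {l | Reducible S P l}) (Submodule.mul_mem_mul h (htop z))
      rw [wordSpan_mul, wordSpan_le_iff]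
      rintro _ ⟨u, hu, w, -, rfl⟩
      exact hu.mono (List.prefix_append _ _).isInfix)
  have hI : ∀ y, y ∈ I ↔ y ∈ wordSpan x {l | Reducible S P l} := fun y =>
    TwoSidedIdeal.mem_mk' _ _ _ _ _ _ y
  constructor
  · intro h
    rw [← hI]
    refine (TwoSidedIdeal.span_le.2 ?_ : R.ideal ≤ I) h
    intro y hy
    simp only [Set.mem_iUnion] at hy
    obtain ⟨s, hs, hy⟩ := hy
    rw [SetLike.mem_coe, hI]
    rw [hR s hs] at hy
    exact (wordSpan_le_iff x).2 (fun l hl =>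
      (⟨s, hs, l, hl, List.infix_rfl⟩ : Reducible S P l)) hy
  · intro h
    rw [wordSpan] at h
    induction h using Submodule.span_induction with
    | mem y hy =>
      obtain ⟨l, hl, rfl⟩ := hy
      obtain ⟨s, hs, p, hp, u, v, rfl⟩ : Reducible S P l := hl
      rw [word_append, word_append]
      refine TwoSidedIdeal.mul_mem_right _ _ _ (TwoSidedIdeal.mul_mem_left _ _ _ ?_)
      refine TwoSidedIdeal.subset_span (Set.mem_biUnion hs ?_)
      rw [hR s hs, SetLike.mem_coe, word_mem_wordSpan]
      exact hp
    | zero => exact zero_mem _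
    | add y z _ _ hy hz => exact add_mem hy hz
    | smul c y _ hy =>
      rw [Algebra.smul_def]
      exact TwoSidedIdeal.mul_mem_left _ _ _ hy

theorem proj_eq_zero_iff (hR : ∀ s ∈ S, R.rel s = wordSpan x (P s)) (t : TensorAlgebra k V) :
    R.proj t = 0 ↔ t ∈ wordSpan x {l | Reducible S P l} := by
  rw [← mem_ideal_iff hR, TwoSidedIdeal.mem_iff, ← RingCon.eq]
  rfl

theorem proj_word_eq_zero_iff (hR : ∀ s ∈ S, R.rel s = wordSpan x (P s)) (l : List ι) :
    R.proj (word x l) = 0 ↔ Reducible S P l := by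
  rw [proj_eq_zero_iff hR, word_mem_wordSpan]; rfl

/-- The kernel of the projection is spanned by the remaining words, hence is disjoint from the span
of the irreducible ones. -/
theorem linearIndepOn_proj_word (hR : ∀ s ∈ S, R.rel s = wordSpan x (P s)) :
    LinearIndepOn k (fun l => R.proj (word x l)) {l | ¬ Reducible S P l} := by
  have h : LinearIndependent k (fun l : {l | ¬ Reducible S P l} => word x l) :=
    (linearIndependent_word x).comp _ Subtype.val_injective
  refine h.map (f := R.proj.toLinearMap) ?_
  have h1 : LinearMap.ker R.proj.toLinearMap = wordSpan x {l | Reducible S P l} := by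
    ext t
    exact proj_eq_zero_iff hR t
  have h2 : Set.range (fun l : {l | ¬ Reducible S P l} => word x l) =
      word x '' {l | ¬ Reducible S P l} := (Set.image_eq_range _ _).symm
  rw [h1, h2]
  refine (linearIndependent_word x).disjoint_span_image ?_
  exact Set.disjoint_left.2 fun l h h' => h h'

variable (R x) in
/-- The element `α ⊗ w` of `A ⊗ T(V)` attached to a pair of words. -/
noncomputable def pairWord (p : List ι × List ι) : R.Alg ⊗[k] TensorAlgebra k V :=
  R.proj (word x p.1) ⊗ₜ[k] word x p.2

theorem pairWord_eq_zero (hR : ∀ s ∈ S, R.rel s = wordSpan x (P s)) {p : List ι × List ι}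
    (hp : Reducible S P p.1) : R.pairWord x p = 0 := by
  rw [pairWord, (proj_word_eq_zero_iff hR _).2 hp, TensorProduct.zero_tmul]

theorem linearIndepOn_pairWord (hR : ∀ s ∈ S, R.rel s = wordSpan x (P s)) :
    LinearIndepOn k (R.pairWord x) {p | ¬ Reducible S P p.1} := by
  have h := TensorProduct.LinearIndepOn.tmul_of_flat_left (linearIndepOn_proj_word hR)
    ((linearIndepOn_univ_iff (R := k)).2 (linearIndependent_word x))
  have h2 : {p : List ι × List ι | ¬ Reducible S P p.1} =
      {l | ¬ Reducible S P l} ×ˢ Set.univ := by ext; simp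
  rw [h2]
  exact h

theorem step_pow_pairWord (c : ℕ) (p : List ι × List ι) (hc : c ≤ p.2.length) :
    (R.step ^ c) (R.pairWord x p) = R.pairWord x (p.1 ++ p.2.take c, p.2.drop c) := by
  induction c generalizing p with
  | zero => simp
  | succ c ih =>
    obtain ⟨α, w⟩ := p
    rcases w with _ | ⟨y, w⟩
    · simp at hc
    · have h : R.step (R.pairWord x (α, y :: w)) = R.pairWord x (α ++ [y], w) := by
        simp only [pairWord]
        rw [word_cons, step_tmul_ι_mul, ← map_mul, word_append]
        simp [word]
      rw [pow_succ, Module.End.mul_apply, h, ih _ (by simpa using hc)]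
      simp

theorem deltaHat_pairWord (hP : IsMinimalRelations S P) {i : ℕ} (hi : 1 ≤ i)
    {p : List ι × List ι} (hp : p.2 ∈ chainWords S P i) :
    R.deltaHat i (R.pairWord x p) = R.pairWord x (shift i p) := by
  rcases Nat.mod_two_eq_zero_or_one i with h | h
  · have h2 : 2 ≤ i := by omega
    rw [chainWords_of_two_le h2] at hp
    obtain ⟨s, hs, hp⟩ := hp
    have hw : word x p.2 ∈ tpow k V (nDeg s i) := by
      rw [tpow_eq_wordSpan x, word_mem_wordSpan]
      exact hp.1
    rw [pairWord, R.deltaHat_of_even h h2 hs _ hw, ← pairWord, step_pow_pairWord, shift, hp.1,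
      cutLen_even h h2]
    have := nDeg_ge (s := s) h2
    rw [hp.1]
    omega
  · have hl : 1 ≤ p.2.length := by
      rcases Nat.lt_or_ge i 2 with h2 | h2
      · rw [chainWords, if_pos h2] at hp
        exact hi.trans_eq hp.symm
      · rw [chainWords_of_two_le h2] at hp
        obtain ⟨s, hs, hp⟩ := hp
        have := nDeg_ge (s := s) h2
        have := hP.two_le s hs
        rw [hp.1]
        omega
    rw [R.deltaHat_of_odd h, ← pow_one R.step, step_pow_pairWord 1 p hl, shift, cutLen_odd h]

/-- The pairs of words spanning `K(A)_i`. -/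
def chainPairs (S : Finset ℕ) (P : ℕ → Set (List ι)) (i : ℕ) : Set (List ι × List ι) :=
  {p | ¬ Reducible S P p.1 ∧ p.2 ∈ chainWords S P i}

/-- The images of all words span `A`; pairs with a reducible left word are zero and can be dropped
from the spanning set. -/
theorem range_incl (hP : IsMinimalRelations S P) (hR : ∀ s ∈ S, R.rel s = wordSpan x (P s))
    (i : ℕ) : (LinearMap.range (R.incl i)).restrictScalars k =
      Submodule.span k (R.pairWord x '' chainPairs S P i) := by
  apply le_antisymm
  · rintro _ ⟨z, rfl⟩
    have h1 : Submodule.map₂ (TensorProduct.mk k R.Alg (TensorAlgebra k V)) ⊤ (R.J i) ≤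
        Submodule.span k (R.pairWord x '' {p | p.2 ∈ chainWords S P i}) := by
      have h2 : (⊤ : Submodule k R.Alg) =
          Submodule.span k (R.proj.toLinearMap '' (word x '' Set.univ)) := by
        rw [Submodule.span_image, ← wordSpan, eq_comm, Submodule.eq_top_iff']
        intro y
        obtain ⟨t, rfl⟩ := RingCon.mkₐ_surjective (α := k) R.ideal.ringCon y
        exact ⟨t, by simp [mem_wordSpan], rfl⟩
      rw [h2, J_eq_wordSpan hP hR, wordSpan, Submodule.map₂_span_span]
      refine Submodule.span_mono ?_
      rintro _ ⟨_, ⟨_, ⟨α, -, rfl⟩, rfl⟩, _, ⟨w, hw, rfl⟩, rfl⟩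
      exact ⟨(α, w), hw, rfl⟩
    have h3 := span_image_le_of_eq_zero (k := k) (v := R.pairWord x)
      (T := {p | p.2 ∈ chainWords S P i}) (N := {p | ¬ Reducible S P p.1})
      (fun p hp => pairWord_eq_zero hR (not_not.1 hp))
    have h4 : {p | p.2 ∈ chainWords S P i} ∩ {p | ¬ Reducible S P p.1} = chainPairs S P i := by
      ext
      simp [chainPairs, and_comm]
    rw [h4] at h3
    refine h3 (h1 ?_)
    induction z using TensorProduct.induction_on with
    | zero => simp
    | tmul α w => exact Submodule.apply_mem_map₂ _ trivial w.2
    | add y z hy hz => rw [map_add]; exact add_mem hy hz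
  · rw [Submodule.span_le]
    rintro _ ⟨p, hp, rfl⟩
    have hw : word x p.2 ∈ R.J i := by
      rw [J_eq_wordSpan hP hR, word_mem_wordSpan]
      exact hp.2
    exact ⟨R.proj (word x p.1) ⊗ₜ ⟨_, hw⟩, rfl⟩

end RelationSpace
-- Exactness of the complex
namespace RelationSpace

variable {k V ι : Type*} [Field k] [AddCommGroup V] [Module k V] {S : Finset ℕ}
  {R : RelationSpace k V S} {x : Module.Basis ι k V} {P : ℕ → Set (List ι)}

/-- The inclusions into `A ⊗ T(V)` are injective, so exactness can be tested in this one ambient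
module. -/
theorem exact_delta_iff (i : ℕ) : Function.Exact (R.delta (i + 1)) (R.delta i) ↔
    ∀ m ∈ LinearMap.range (R.incl (i + 1)), R.deltaHat (i + 1) m = 0 ↔
      ∃ m' ∈ LinearMap.range (R.incl (i + 2)), R.deltaHat (i + 2) m' = m := by
  have h1 : ∀ z, R.delta i z = 0 ↔ R.deltaHat (i + 1) (R.incl (i + 1) z) = 0 := fun z => by
    rw [← incl_delta, ← (R.incl_injective i).eq_iff, map_zero]
  have h2 : ∀ z, z ∈ Set.range (R.delta (i + 1)) ↔
      ∃ m' ∈ LinearMap.range (R.incl (i + 2)), R.deltaHat (i + 2) m' = R.incl (i + 1) z := by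
    intro z
    constructor
    · rintro ⟨y, rfl⟩
      exact ⟨_, ⟨y, rfl⟩, (R.incl_delta (i + 1) y).symm⟩
    · rintro ⟨_, ⟨y, rfl⟩, h⟩
      exact ⟨y, R.incl_injective (i + 1) ((R.incl_delta (i + 1) y).trans h)⟩
  constructor
  · rintro h _ ⟨z, rfl⟩
    rw [← h1, h z, h2]
  · intro h z
    rw [h1, h _ ⟨z, rfl⟩, h2]

theorem mem_range_incl_iff (hP : IsMinimalRelations S P)
    (hR : ∀ s ∈ S, R.rel s = wordSpan x (P s)) {i : ℕ} {m : R.Alg ⊗[k] TensorAlgebra k V} :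
    m ∈ LinearMap.range (R.incl i) ↔
      m ∈ Submodule.span k (R.pairWord x '' chainPairs S P i) := by
  rw [← range_incl hP hR, Submodule.restrictScalars_mem]

theorem mem_map_deltaHat (hP : IsMinimalRelations S P)
    (hR : ∀ s ∈ S, R.rel s = wordSpan x (P s)) {i : ℕ} (hi : 1 ≤ i)
    {m : R.Alg ⊗[k] TensorAlgebra k V} :
    (∃ m' ∈ LinearMap.range (R.incl i), R.deltaHat i m' = m) ↔
      m ∈ Submodule.span k (R.pairWord x '' (shift i '' chainPairs S P i)) := by
  have h : R.pairWord x '' (shift i '' chainPairs S P i) =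
      (R.deltaHat i).restrictScalars k '' (R.pairWord x '' chainPairs S P i) := by
    rw [Set.image_image, Set.image_image]
    exact Set.image_congr fun p hp => (deltaHat_pairWord hP hi hp.2).symm
  rw [h, Submodule.span_image, Submodule.mem_map]
  simp only [mem_range_incl_iff hP hR, LinearMap.restrictScalars_apply]

theorem exact_delta (hP : IsMinimalRelations S P) (hR : ∀ s ∈ S, R.rel s = wordSpan x (P s))
    (hO : OverlapCondition S P) (i : ℕ) :
    Function.Exact (R.delta (i + 1)) (R.delta i) := by
  rw [exact_delta_iff]
  intro m hm
  rw [mem_range_incl_iff hP hR] at hm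
  rw [mem_map_deltaHat hP hR (by omega)]
  constructor
  · intro h0
    have h := mem_span_of_map_eq_zero (v := R.pairWord x) (v' := R.pairWord x)
      (φ := shift (i + 1)) (f := (R.deltaHat (i + 1)).restrictScalars k)
      (N := {p | ¬ Reducible S P p.1})
      (fun p hp => deltaHat_pairWord hP (by omega) hp.2)
      (fun p hp => pairWord_eq_zero hR (not_not.1 hp))
      (linearIndepOn_pairWord hR)
      (fun p hp q hq hpq => shift_inj hP (by omega) hp.1.2 hq.1.2 hpq) hm h0
    refine Submodule.span_mono (Set.image_mono ?_) h
    rintro p ⟨⟨hn, hp⟩, hr⟩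
    obtain ⟨q, hq, hqn, hqp⟩ := exists_shift_eq hP hO (by omega) hp hn (not_not.1 hr)
    exact ⟨q, ⟨hqn, hq⟩, hqp⟩
  · intro h
    have hle : Submodule.span k (R.pairWord x '' (shift (i + 2) '' chainPairs S P (i + 2))) ≤
        LinearMap.ker ((R.deltaHat (i + 1)).restrictScalars k) := by
      rw [Submodule.span_le]
      rintro _ ⟨_, ⟨p, hp, rfl⟩, rfl⟩
      rw [SetLike.mem_coe, LinearMap.mem_ker, LinearMap.restrictScalars_apply,
        deltaHat_pairWord hP (by omega) (shift_snd_mem_chainWords hP (by omega) hp.2)]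
      exact pairWord_eq_zero hR (reducible_shift_shift hP hp.2)
    exact hle h

theorem algebraMapInv_word (l : List ι) :
    TensorAlgebra.algebraMapInv (word x l) = if l = [] then (1 : k) else 0 := by
  cases l with
  | nil => simp [word_nil]
  | cons y l => simp [word_cons, TensorAlgebra.algebraMapInv]

variable (R) in
/-- The augmentation `A ⊗ T(V) → k`. -/
noncomputable def augHat : R.Alg ⊗[k] TensorAlgebra k V →ₗ[k] k :=
  LinearMap.mul' k k ∘ₗ TensorProduct.map R.augmentation.toLinearMap
    (TensorAlgebra.algebraMapInv : TensorAlgebra k V →ₐ[k] k).toLinearMap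

theorem delta0_eq (z : R.K 0) : R.delta0 z = R.augHat (R.incl 0 z) := by
  induction z using TensorProduct.induction_on with
  | zero => simp
  | tmul α w => rfl
  | add y z hy hz => rw [map_add, map_add, map_add, hy, hz]

open scoped Classical in
theorem augHat_pairWord (p : List ι × List ι) :
    R.augHat (R.pairWord x p) = if p = ([], []) then 1 else 0 := by
  have h : R.augHat (R.pairWord x p) =
      TensorAlgebra.algebraMapInv (word x p.1) * TensorAlgebra.algebraMapInv (word x p.2) := rfl
  rw [h, algebraMapInv_word, algebraMapInv_word]
  by_cases h1 : p.1 = [] <;> by_cases h2 : p.2 = [] <;>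
    simp [h1, h2, Prod.ext_iff]

open scoped Classical in
-- The kernel argument with target `k`: only the pair of empty words survives the augmentation. Any
-- other left word gives up its last letter, which produces a preimage, so no overlap condition is
-- needed.
theorem exact_delta_zero (hP : IsMinimalRelations S P)
    (hR : ∀ s ∈ S, R.rel s = wordSpan x (P s)) : Function.Exact (R.delta 0) R.delta0 := by
  intro z
  have hz := (mem_range_incl_iff (x := x) hP hR).1 ⟨z, rfl⟩
  have h2 : z ∈ Set.range (R.delta 0) ↔
      ∃ m' ∈ LinearMap.range (R.incl 1), R.deltaHat 1 m' = R.incl 0 z := by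
    constructor
    · rintro ⟨y, rfl⟩
      exact ⟨_, ⟨y, rfl⟩, (R.incl_delta 0 y).symm⟩
    · rintro ⟨_, ⟨y, rfl⟩, h⟩
      exact ⟨y, R.incl_injective 0 ((R.incl_delta 0 y).trans h)⟩
  rw [delta0_eq, h2, mem_map_deltaHat hP hR le_rfl]
  have hs : ∀ α y, shift 1 (α, [y]) = ((α ++ [y], []) : List ι × List ι) := fun α y => by
    simp [shift, cutLen]
  constructor
  · intro h0
    have h := mem_span_of_map_eq_zero (v := R.pairWord x) (φ := id) (f := R.augHat)
      (v' := fun p : List ι × List ι => if p = ([], []) then (1 : k) else 0)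
      (N := {([], [])}) (fun p _ => augHat_pairWord p) (fun p hp => if_neg hp)
      (LinearIndepOn.singleton (by simp)) (Set.injOn_id _) hz h0
    refine Submodule.span_mono (Set.image_mono ?_) h
    rintro ⟨α, w⟩ ⟨⟨hα, hw⟩, hne⟩
    obtain rfl : w = [] := List.length_eq_zero_iff.1 hw
    rcases List.eq_nil_or_concat' α with rfl | ⟨β, y, rfl⟩
    · exact absurd rfl hne
    · exact ⟨(β, [y]), ⟨fun h => hα (h.mono (List.prefix_append _ _).isInfix), rfl⟩, hs β y⟩
  · intro h
    have hle : Submodule.span k (R.pairWord x '' (shift 1 '' chainPairs S P 1)) ≤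
        LinearMap.ker R.augHat := by
      rw [Submodule.span_le]
      rintro _ ⟨_, ⟨⟨α, w⟩, ⟨-, hw⟩, rfl⟩, rfl⟩
      obtain ⟨y, rfl⟩ : ∃ y, w = [y] := List.length_eq_one_iff.1 hw
      rw [SetLike.mem_coe, LinearMap.mem_ker, augHat_pairWord, hs]
      simp
    exact hle h

theorem delta0_surjective : Function.Surjective R.delta0 := by
  intro c
  have h1 : (1 : TensorAlgebra k V) ∈ R.J 0 := by simp [J]
  refine ⟨c • ((1 : R.Alg) ⊗ₜ[k] ⟨1, h1⟩), ?_⟩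
  rw [map_smul]
  simp [delta0]

/-- For monomial relations, the multi-Koszul property is a condition on overlaps. -/
theorem isMultiKoszul_iff_overlapCondition (hP : IsMinimalRelations S P)
    (hR : ∀ s ∈ S, R.rel s = wordSpan x (P s)) :
    R.IsMultiKoszul ↔ OverlapCondition S P := by
  constructor
  · rintro ⟨-, -, -, h⟩
    -- Exactness at `K(A)_2` alone already gives the overlap condition.
    refine overlapCondition_of_exists_shift_eq hP fun p hp hn hr => ?_
    have hm : R.pairWord x p ∈ LinearMap.range (R.incl 2) :=
      (mem_range_incl_iff hP hR).2 (Submodule.subset_span ⟨p, ⟨hn, hp⟩, rfl⟩)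
    have h0 : R.deltaHat 2 (R.pairWord x p) = 0 := by
      rw [deltaHat_pairWord hP (by omega) hp, pairWord_eq_zero hR hr]
    have h3 := (mem_map_deltaHat hP hR (by omega)).1 (((exact_delta_iff 1).1 (h 1) _ hm).1 h0)
    obtain ⟨q, hq, rfl⟩ := mem_of_mem_span_image (v := R.pairWord x)
      (N := {p | ¬ Reducible S P p.1}) (linearIndepOn_pairWord hR) (fun p hp => pairWord_eq_zero hR (not_not.1 hp)) hn h3
    exact ⟨q, hq.2, rfl⟩
  · intro hO
    exact ⟨fun i => inferInstance, delta0_surjective, exact_delta_zero hP hR,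
      exact_delta hP hR hO⟩

/-! ### From subspaces to words and back -/

theorem HasMonomialBasis.exists_words (h : R.HasMonomialBasis) :
    ∃ (m : ℕ) (x : Module.Basis (Fin m) k V) (P : ℕ → Set (List (Fin m))),
      IsMinimalRelations S P ∧ ∀ s ∈ S, R.rel s = wordSpan x (P s) := by
  obtain ⟨m, x, B, hB, -, hspan⟩ := h
  have hBw : B = word x '' {l | word x l ∈ B} := by
    ext w
    constructor
    · intro hw
      obtain ⟨l, rfl⟩ := hB w hw
      exact ⟨l, hw, rfl⟩
    · rintro ⟨l, hl, rfl⟩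
      exact hl
  rw [hBw] at hspan
  change wordSpan x _ = _ at hspan
  let P : ℕ → Set (List (Fin m)) := fun s => {l | l.length = s ∧ word x l ∈ R.rel s}
  -- The monomial basis is given for the whole of `R`; projecting to degree `s` shows that its
  -- monomials of length `s` lie in `R_s`.
  have hproj : ∀ s ∈ S, ⨆ t ∈ S, R.rel t ≤
      (R.rel s).comap (GradedAlgebra.proj (fun n => tpow k V n) s) := by
    intro s hs
    refine iSup₂_le fun t ht w hw => ?_
    rw [Submodule.mem_comap, GradedAlgebra.proj_apply]
    by_cases hst : t = s
    · subst hst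
      rwa [DirectSum.decompose_of_mem_same _ (R.rel_le t ht hw)]
    · rw [DirectSum.decompose_of_mem_ne (fun n => tpow k V n) (R.rel_le t ht hw) hst]
      exact zero_mem _
  refine ⟨m, x, P, ⟨R.two_le, fun s _ w hw => hw.1, ?_⟩, fun s hs => le_antisymm ?_ ?_⟩
  · rintro s hs t ht p ⟨hp, hp'⟩ q ⟨hq, hq'⟩ hqp
    by_cases hst : t = s
    · exact hqp.eq_of_length (by omega)
    · exfalso
      -- A relation of another degree inside `p` would put `p` into the intersection that minimality
      -- declares zero.
      refine (linearIndependent_word x).ne_zero p ?_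
      rw [← Submodule.mem_bot k, ← R.minimality s hs]
      refine ⟨hp', ?_⟩
      obtain ⟨u, v, rfl⟩ := hqp
      simp only [List.length_append] at hp
      refine Submodule.mem_iSup_of_mem t (Submodule.mem_iSup_of_mem (by simp [hst, ht])
        (Submodule.mem_iSup_of_mem u.length (Submodule.mem_iSup_of_mem (by simp; omega) ?_)))
      rw [word_append, word_append]
      have hv : s - t - u.length = v.length := by omega
      have hw : ∀ l : List (Fin m), word x l ∈ tpow k V l.length := fun l => by
        rw [tpow_eq_wordSpan x, word_mem_wordSpan]
        rfl
      rw [hv]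
      exact Submodule.mul_mem_mul (Submodule.mul_mem_mul (hw u) hq') (hw v)
  · have h1 : R.rel s ≤ wordSpan x ({l | word x l ∈ B} ∩ {l | l.length = s}) := by
      rw [wordSpan_inter, hspan, ← tpow_eq_wordSpan x]
      exact le_inf (le_iSup₂_of_le s hs le_rfl) (R.rel_le s hs)
    refine h1.trans ((wordSpan_le_iff x).2 ?_)
    rintro l ⟨hl, hls⟩
    refine ⟨hls, ?_⟩
    have h2 : word x l ∈ ⨆ t ∈ S, R.rel t := hspan ▸ (word_mem_wordSpan x).2 hl
    have h3 := hproj s hs h2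
    have h4 : word x l ∈ tpow k V s := by
      rw [tpow_eq_wordSpan x, word_mem_wordSpan]
      exact hls
    rwa [Submodule.mem_comap, GradedAlgebra.proj_apply,
      DirectSum.decompose_of_mem_same _ h4] at h3
  · rw [wordSpan, Submodule.span_le]
    rintro _ ⟨l, hl, rfl⟩
    exact hl.2

/-- Both sides are spans of words, so the inclusion is one of sets, tested on words cut after `m`
letters. The set `Z` serves two cases: reducible words give the term `I_m ⊗ R_a` of (2), and the
empty set gives no second term. -/
theorem inf_le_iff_overlapAt (hP : IsMinimalRelations S P)
    (hR : ∀ s ∈ S, R.rel s = wordSpan x (P s)) {s t m : ℕ} (hs : s ∈ S) (ht : t ∈ S)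
    (hm : 1 ≤ m) (Z : Set (List ι)) :
    (tpow k V m * R.rel s) ⊓ (⨆ j ∈ Finset.range (m + s - t),
        tpow k V j * R.rel t * tpow k V (m + s - t - j)) ≤
      tpow k V (m - 1) * R.Jbar s (s + 1) ⊔ wordSpan x {l | l.length = m ∧ l ∈ Z} * R.rel s ↔
    OverlapAt P s t m (m + s - t) Z := by
  rw [Jbar_eq_wordSpan hP hR hs (by omega), hR s hs, hR t ht, tpow_mul_wordSpan,
    tpow_mul_wordSpan, wordSpan_mul, ← wordSpan_union]
  simp only [tpow_mul_wordSpan_mul_tpow x _ _ (hP.length_eq t ht), ← wordSpan_iUnion]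
  rw [← wordSpan_inter, wordSpan_le_iff]
  constructor
  · intro h α w hα hw j hj hjt
    have hl := hP.length_eq s hs w hw
    have hd : (α ++ w).drop m = w := by rw [← hα, List.drop_left]
    rcases @h (α ++ w) ⟨⟨by simp; omega, by rwa [hd]⟩, by
      simp only [Set.mem_iUnion, Finset.mem_range]
      exact ⟨j, hj, by simp; omega, hjt⟩⟩ with ⟨-, h⟩ | ⟨α', ⟨hα', hZ⟩, w', -, h⟩
    · exact Or.inl ((drop_mem_chain_iff hP hs hm hα hw).1 h)
    · obtain ⟨rfl, -⟩ := List.append_inj h (hα'.trans hα.symm)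
      exact Or.inr hZ
  · rintro h l ⟨⟨hml, hw⟩, hj⟩
    simp only [Set.mem_iUnion, Finset.mem_range] at hj
    obtain ⟨j, hj, -, hjt⟩ := hj
    have hα : (l.take m).length = m := by simpa using hml
    have hl : l.take m ++ l.drop m = l := List.take_append_drop m l
    rcases h _ _ hα hw j hj (by rwa [hl]) with h | h
    · left
      rw [← drop_mem_chain_iff hP hs hm hα hw, hl] at h
      exact ⟨by omega, h⟩
    · exact Or.inr ⟨_, ⟨hα, h⟩, _, hw, hl⟩

theorem inf_le_iff_overlapAt_empty (hP : IsMinimalRelations S P)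
    (hR : ∀ s ∈ S, R.rel s = wordSpan x (P s)) {s t m : ℕ} (hs : s ∈ S) (ht : t ∈ S)
    (hm : 1 ≤ m) :
    (tpow k V m * R.rel s) ⊓ (⨆ j ∈ Finset.range (m + s - t),
        tpow k V j * R.rel t * tpow k V (m + s - t - j)) ≤
      tpow k V (m - 1) * R.Jbar s (s + 1) ↔
    OverlapAt P s t m (m + s - t) ∅ := by
  rw [← inf_le_iff_overlapAt hP hR hs ht hm]
  have h : {l : List ι | l.length = m ∧ l ∈ (∅ : Set (List ι))} = ∅ := by ext; simp
  rw [h, wordSpan_empty, Submodule.bot_mul, sup_bot_eq]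

/-- Only one inclusion is a condition. The other always holds: the two windows of a word in
`J̄^s_{s+1}` place it in `V^{(s-1)} ⊗ R_s` and in the summand `j = s - 2`. -/
theorem extraCondition_iff_overlapAt (hP : IsMinimalRelations S P)
    (hR : ∀ s ∈ S, R.rel s = wordSpan x (P s)) {s : ℕ} (hs : s ∈ S) :
    R.ExtraCondition s ↔ OverlapAt P s s (s - 1) (s - 1) ∅ := by
  have h2 := hP.two_le s hs
  have h := inf_le_iff_overlapAt_empty hP hR (m := s - 1) hs hs (by omega)
  have h3 : s - 1 + s - s = s - 1 := by omega
  have h4 : s - 1 - 1 = s - 2 := by omega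
  rw [h3, h4] at h
  rw [← h, ExtraCondition]
  refine ⟨le_of_eq, fun h => le_antisymm h ?_⟩
  have hj := R.Jbar_eq_wordSpan hP hR hs (n := s + 1) (by omega)
  refine le_inf ?_ (le_iSup₂_of_le (s - 2) (Finset.mem_range.2 (by omega)) ?_)
  · rw [hj, hR s hs, tpow_mul_wordSpan, tpow_mul_wordSpan, wordSpan_le_iff]
    rintro l ⟨hl, hc⟩
    have h5 := hc.2 1 (by omega)
    have h6 := hc.1
    rw [List.length_drop] at h6
    rw [List.drop_drop, List.take_of_length_le (by simp; omega)] at h5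
    have h7 : s - 2 + 1 = s - 1 := by omega
    rw [h7] at h5
    exact ⟨by omega, h5⟩
  · rw [hj, hR s hs, tpow_mul_wordSpan, tpow_mul_wordSpan_mul_tpow x _ _ (hP.length_eq s hs),
      wordSpan_le_iff]
    rintro l ⟨hl, hc⟩
    have h6 := hc.1
    rw [List.length_drop] at h6
    exact ⟨by omega, take_mem_of_mem_chain hc (by omega)⟩

end RelationSpace
end MultiKoszul

theorem mainTheorem8 {k : Type*} {V : Type*} [Field k] [AddCommGroup V] [Module k V]
    [FiniteDimensional k V] (a b : ℕ) (ha : 2 ≤ a) (hab : a < b)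
    (R : MultiKoszul.RelationSpace k V {a, b}) (hR : R.HasMonomialBasis) :
    R.IsMultiKoszul ↔
      (R.ExtraCondition a ∧ R.ExtraCondition b) ∧
      (∀ m : ℕ, b - a + 1 ≤ m → m ≤ b - 1 →
        (MultiKoszul.tpow k V m * R.rel a) ⊓
            (⨆ j ∈ Finset.range (m + a - b),
              MultiKoszul.tpow k V j * R.rel b * MultiKoszul.tpow k V (m + a - b - j)) ≤
          MultiKoszul.tpow k V (m - 1) * R.Jbar a (a + 1) ⊔ R.idealDeg m * R.rel a) ∧
      (∀ m : ℕ, 1 ≤ m → m ≤ a - 1 →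
        (MultiKoszul.tpow k V m * R.rel b) ⊓
            (⨆ j ∈ Finset.range (m + b - a),
              MultiKoszul.tpow k V j * R.rel a * MultiKoszul.tpow k V (m + b - a - j)) ≤
          MultiKoszul.tpow k V (m - 1) * R.Jbar b (b + 1)) := by
  obtain ⟨n, x, P, hP, hRP⟩ := hR.exists_words
  have h1 : a ∈ ({a, b} : Finset ℕ) := by simp
  have h2 : b ∈ ({a, b} : Finset ℕ) := by simp
  rw [MultiKoszul.RelationSpace.isMultiKoszul_iff_overlapCondition hP hRP,
    MultiKoszul.overlapCondition_pair_iff hab hP,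
    MultiKoszul.RelationSpace.extraCondition_iff_overlapAt hP hRP h1,
    MultiKoszul.RelationSpace.extraCondition_iff_overlapAt hP hRP h2]
  refine and_congr_right' (and_congr ?_ ?_)
  · refine forall_congr' fun m => forall_congr' fun hm => forall_congr' fun _ => ?_
    rw [← MultiKoszul.RelationSpace.inf_le_iff_overlapAt hP hRP h1 h2 (by omega),
      MultiKoszul.RelationSpace.idealDeg_eq_wordSpan hP hRP]
    rfl
  · refine forall_congr' fun m => forall_congr' fun hm => forall_congr' fun _ => ?_
    rw [MultiKoszul.RelationSpace.inf_le_iff_overlapAt_empty hP hRP h2 h1 hm]
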